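/- Let $B=(V,E,\preceq)$ be a stationary, properly ordered Bratteli diagram (unique infinite path of maximal edges, unique infinite path of minimal edges), with the vertices of every level $n\ge 1$ labelled by a finite set $\{1,\dots,m\}$, the same ordered edge set between levels $n$ and $n+1$ for all $n\ge1$, and incidence matrix $M$ ($M_{i,j}$ = number of edges from $i$ to $j$). Assume: (H1) all entries of $M$ are positive; (H2) each vertex of level $1$ receives exactly one edge from the top vertex $v_0$; (H3) every minimal edge between levels $n$ and $n+1$, $n\ge 1$, starts at vertex $1$. Let $X_B$ be the space of infinite paths from $v_0$, assumed to have no isolated point (so that it is a Cantor set), let $V_B$ be the Vershik map and $\mu$ a $V_B$-invariant Borel probability measure on $X_B$. Let $\lambda$ be the Perron eigenvalue of $M$, with positive right and left eigenvectors $r$, $l$ normalized by $\sum_i r(i)=1$, $\sum_i l(i)r(i)=1$. Write $\mathbf s(e),\mathbf t(e)$ for the initial and terminal vertices of an edge $e$, and $E(k,l)$ for the set of paths $e_k\cdots e_l$ from level $k-1$ to level $l$. Fix $x^*\in X_B$, put $I_n=[x^*_1,\dots,x^*_n]$, and let $\mathcal N$ be an infinite set of integers $n\ge1$ such that $\mathbf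 t(x^*_n)=i^*$ for all $n\in\mathcal N$. Let $N_n^{(0)}=0$, $N_n^{(k)}(x)=\inf\{j>N_n^{(k-1)}(x): V_B^j x\in I_n\}$ and $T_n^{(k)}=N_n^{(k)}-N_n^{(k-1)}$ for $k\ge1$, and let $$\tau_n(x)=\sum_{k\ge1}\delta_{N_n^{(k)}(x)\,\mu(I_n)},$$ a random locally finite measure on $[0,\infty)$ when $x$ is chosen according to $\mu$. 1. There are numbers $c(ef)(i)$, not depending on $n\in\mathcal N$, such that for every $n\in\mathcal N$, every path $ef$ from level $n$ to level $n+2$ with $\mathbf s(e)=i^*$ and every $x\in[I_nef]$, $c(ef)(i)$ is the number of $j$ with $0<j\le N_n^{(1)}(x)$ such that $V_B^jx$ lies in the cylinder of the minimal path from $v_0$ to the vertex $i$ of level $n$. Put $\bar c(ef)=\sum_i c(ef)(i)\,l(i)$. 2. For every path $e_1\cdots e_{p+1}$ with $\mathbf s(e_1)=i^*$ and every $1\le k\le p$ there is a unique path $e_1^{(k)}e_2^{(k)}$, not depending on $n\in\mathcal N$, such that $V_B^{N_n^{(k-1)}(x)}(x)\in[I_ne_1^{(k)}e_2^{(k)}]$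 for every $n\in\mathcal N$ and every $x\in[I_ne_1\cdots e_{p+1}]$. 3. For $p\ge1$ and $(t_1,\dots,t_p)\in\mathbb R^p$ let, with $t_1^+=\max(t_1,0)$, $$F_{1,\dots,p}(t_1,\dots,t_p)=\sum_{e_1\cdots e_{p+1}\in E(2,p+2):\ \mathbf s(e_1)=i^*}\min\Big(\frac{t_1^+}{r(i^*)},\bar c(e_1e_2)\Big)\ \prod_{k=2}^p \mathbf 1_{\{\bar c(e_1^{(k)}e_2^{(k)})\le t_k/r(i^*)\}}\ \frac{r(\mathbf t(e_{p+1}))}{\lambda^{p+1}}.$$ Then $\mu\{x: T_n^{(1)}(x)\mu(I_n)\le t_1,\dots,T_n^{(p)}(x)\mu(I_n)\le t_p\}\to F_{1,\dots,p}(t_1,\dots,t_p)$ as $n\to\infty$ in $\mathcal N$, at every continuity point $(t_1,\dots,t_p)$ of $F_{1,\dots,p}$. 4. There is a sequence of random variables $S_1,S_2,\dots\ge0$ with $P(S_1\le t_1,\dots,S_p\le t_p)=F_{1,\dots,p}(t_1,\dots,t_p)$ for all $p\ge1$ and all $(t_1,\dots,t_p)\in\mathbb R^p$, such that $\tau=\sum_{k\ge1}\delta_{S_1+\cdots+S_k}$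 is almost surely a locally finite measure on $[0,\infty)$, and $\tau_n\to\tau$ in law as $n\to\infty$ in $\mathcal N$, for the vague topology on the space of locally finite measures on $[0,\infty)$. -/

import Mathlib

open MeasureTheory Filter Topology
open scoped NNReal CompactlySupported

/-! ### Entrance times and point processes -/

/-- `entranceTime T I k x` is the time `N_I^{(k)}(x)` of the `k`-th visit of `x` to `I` (`k ≥ 1`):
`N_I^{(k)}(x) = inf {n > N_I^{(k-1)}(x) : T^n x ∈ I}`, with `N_I^{(0)} = 0`. -/
noncomputable def entranceTime {X : Type*} (T : X → X) (I : Set X) : ℕ → X → ℕ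
  | 0, _ => 0
  | k + 1, x => sInf {n : ℕ | entranceTime T I k x < n ∧ T^[n] x ∈ I}

/-- The rescaled inter-arrival time `T^{(k+1)}(x) μ(I)`, where `T^{(1)} = N_I^{(1)}` and
`T^{(k+1)} = N_I^{(k+1)} - N_I^{(k)}`. -/
noncomputable def scaledGap {X : Type*} [MeasurableSpace X] (μ : Measure X) (T : X → X)
    (I : Set X) (k : ℕ) (x : X) : ℝ :=
  ((entranceTime T I (k + 1) x : ℝ) - (entranceTime T I k x : ℝ)) * μ.real I

/-- The measure `∑_{k ≥ 1} δ_{N_I^{(k)}(x) μ(I)}` on `[0, ∞)`. -/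
noncomputable def entranceProcess {X : Type*} [MeasurableSpace X] (μ : Measure X) (T : X → X)
    (I : Set X) (x : X) : Measure ℝ≥0 :=
  Measure.sum fun k : ℕ => Measure.dirac ((entranceTime T I (k + 1) x : ℝ≥0) * (μ I).toNNReal)

/-- The renewal-type measure `∑_{k ≥ 1} δ_{s₁ + ⋯ + s_k}` on `[0, ∞)` with inter-arrival times
`s₁ = s 0, s₂ = s 1, …`. -/
noncomputable def arrivalMeasure (s : ℕ → ℝ≥0) : Measure ℝ≥0 :=
  Measure.sum fun k : ℕ => Measure.dirac (∑ j ∈ Finset.range (k + 1), s j)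

/-- The space of locally finite (Radon) measures on `[0, ∞)`, the state space of point processes. -/
def RadonHalfLine : Type := {ν : Measure ℝ≥0 // IsLocallyFiniteMeasure ν}

/-- The vague topology: the coarsest topology for which `ν ↦ ∫ f dν` is continuous for every
continuous compactly supported `f : [0, ∞) → ℝ`. -/
noncomputable instance : TopologicalSpace RadonHalfLine :=
  TopologicalSpace.induced (fun ν (f : C_c(ℝ≥0, ℝ)) => ∫ u, f u ∂ν.1) inferInstance

noncomputable instance : MeasurableSpace RadonHalfLine := borel RadonHalfLine

instance : BorelSpace RadonHalfLine := ⟨rfl⟩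

/-! ### Stationary ordered Bratteli diagrams -/

/-- A stationary ordered Bratteli diagram in which every vertex of level `1` receives exactly one
edge from the top vertex `v₀`. The vertices of every level `n ≥ 1` are labelled by `V`, and the
edges from level `n` to level `n + 1`, `n ≥ 1`, with their order, by `E`: the edge `e` goes from
`src e` (level `n`) to `tgt e` (level `n + 1`), and two edges are comparable if and only if they
have the same terminal vertex. The edges of level `1` are identified with their terminal vertices. -/
structure StationaryDiagram (V E : Type*) [PartialOrder E] where
  src : E → V
  tgt : E → V
  comparable_iff : ∀ e f : E, (e ≤ f ∨ f ≤ e) ↔ tgt e = tgt f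
  exists_src : ∀ v : V, ∃ e : E, src e = v
  exists_tgt : ∀ v : V, ∃ e : E, tgt e = v

namespace StationaryDiagram

variable {V E : Type*} [PartialOrder E] (B : StationaryDiagram V E)

/-- The incidence matrix: `M i j` is the number of edges from `i` to `j`. -/
noncomputable def incidence : Matrix V V ℝ :=
  Matrix.of fun i j => (Nat.card {e : E // B.src e = i ∧ B.tgt e = j} : ℝ)

/-- The space of infinite paths starting at `v₀`. The edge of level `1` of a path `x` is
determined by its terminal vertex `src (x 0)`, and `x n` is the edge from level `n + 1` to level
`n + 2`; thus `src (x n)` is the vertex of level `n + 1` of the path. -/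
def PathSpace : Type _ := {x : ℕ → E // ∀ n, B.tgt (x n) = B.src (x (n + 1))}

/-- The topology generated by the cylinder sets (`E` being discrete). -/
instance : TopologicalSpace B.PathSpace :=
  TopologicalSpace.induced (fun x => x.1) (@Pi.topologicalSpace ℕ (fun _ => E) (fun _ => ⊥))

instance : MeasurableSpace B.PathSpace := borel B.PathSpace

instance : BorelSpace B.PathSpace := ⟨rfl⟩

/-- The finite path `w` (with edges between levels `≥ 1`) starts at the vertex `i`. -/
def IsPathFrom (i : V) {p : ℕ} (w : Fin (p + 1) → E) : Prop :=
  B.src (w 0) = i ∧ ∀ j : Fin p, B.tgt (w j.castSucc) = B.src (w j.succ)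

theorem exists_path_through (i : V) {p : ℕ} (w : Fin (p + 1) → E) (hw : B.IsPathFrom i w) :
    ∃ x : B.PathSpace, ∀ j : Fin (p + 1), x.1 j = w j := by
  choose out hout using B.exists_src
  let y : ℕ → E := fun n => Nat.rec (w (Fin.last p)) (fun _ e => out (B.tgt e)) n
  refine ⟨⟨fun n => if h : n < p + 1 then w ⟨n, h⟩ else y (n - p), fun n => ?_⟩, fun j => ?_⟩
  · rcases lt_trichotomy n p with h | h | h
    · have h1 : n < p + 1 := by omega
      have h2 : n + 1 < p + 1 := by omega
      simpa [h1, h2] using hw.2 ⟨n, h⟩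
    · subst h
      have : n + 1 - n = 0 + 1 := by omega
      simp only [lt_add_iff_pos_right, zero_lt_one, dite_true, lt_self_iff_false, dite_false, this]
      exact (hout _).symm
    · have h1 : ¬ n < p + 1 := by omega
      have h2 : ¬ n + 1 < p + 1 := by omega
      have : n + 1 - p = (n - p) + 1 := by omega
      simp only [h1, h2, dite_false, this]
      exact (hout _).symm
  · have hj := j.isLt
    simp only [hj, dite_true]

theorem exists_path_from (i : V) : ∃ x : B.PathSpace, B.src (x.1 0) = i := by
  obtain ⟨e, he⟩ := B.exists_src i
  obtain ⟨x, hx⟩ := B.exists_path_through i (p := 0) (fun _ => e) ⟨he, fun j => j.elim0⟩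
  exact ⟨x, by simpa [he] using congrArg B.src (hx 0)⟩

instance [Nonempty V] : Nonempty B.PathSpace :=
  ⟨(B.exists_path_from (Classical.arbitrary V)).choose⟩

/-- There is a unique path made of maximal edges and a unique path made of minimal edges. -/
def ProperlyOrdered : Prop :=
  (∃! x : B.PathSpace, ∀ n, IsMax (x.1 n)) ∧ (∃! x : B.PathSpace, ∀ n, IsMin (x.1 n))

/-! ### The Vershik map -/

theorem exists_minEdge [Finite E] (v : V) : ∃ e : E, B.tgt e = v ∧ IsMin e := by
  obtain ⟨e, he⟩ := B.exists_tgt v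
  obtain ⟨f, hf⟩ := (Set.toFinite {e : E | B.tgt e = v}).exists_minimal ⟨e, he⟩
  exact ⟨f, hf.1, fun g hg =>
    hf.2 (((B.comparable_iff g f).1 (Or.inl hg)).trans hf.1) hg⟩

/-- The minimal edge with terminal vertex `v`. -/
noncomputable def minEdge [Finite E] (v : V) : E := (B.exists_minEdge v).choose

theorem tgt_minEdge [Finite E] (v : V) : B.tgt (B.minEdge v) = v :=
  (B.exists_minEdge v).choose_spec.1

open Classical in
/-- The successor of a non-maximal edge (with the same terminal vertex). -/
noncomputable def succEdge (e : E) : E := if h : ∃ f, e ⋖ f then h.choose else e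

theorem tgt_succEdge (e : E) : B.tgt (succEdge e) = B.tgt e := by
  unfold succEdge
  split_ifs with h
  · exact ((B.comparable_iff _ _).1 (Or.inl h.choose_spec.le)).symm
  · rfl

/-- The edges of the minimal path ending at `v`, listed downwards from `v`. -/
noncomputable def descend [Finite E] (v : V) : ℕ → E
  | 0 => B.minEdge v
  | a + 1 => B.minEdge (B.src (descend v a))

/-- If `k` is the smallest index with `x k` not maximal, this is the path
`(f_0, …, f_{k-1}, f_k, x_{k+1}, …)` where `f_k` is the successor of `x k` and
`(f_0, …, f_{k-1})` is the minimal path to the initial vertex of `f_k`. -/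
noncomputable def succPath [Finite E] (x : B.PathSpace) (k : ℕ) : B.PathSpace :=
  ⟨fun j => if j < k then B.descend (B.src (succEdge (x.1 k))) (k - 1 - j)
      else if j = k then succEdge (x.1 k) else x.1 j, fun n => by
    rcases lt_trichotomy n k with h | h | h
    · by_cases h' : n + 1 < k
      · have : k - 1 - n = (k - 1 - (n + 1)) + 1 := by omega
        simp only [h, h', if_true, this]
        exact B.tgt_minEdge _
      · have h1 : n + 1 = k := by omega
        subst h1
        simp only [h, if_true, lt_self_iff_false, if_false, Nat.add_sub_cancel, Nat.sub_self]
        exact B.tgt_minEdge _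
    · subst h
      have h1 : ¬ n + 1 < n := by omega
      simp only [lt_self_iff_false, if_false, if_true, h1, Nat.succ_ne_self]
      rw [B.tgt_succEdge]
      exact x.2 n
    · have h1 : ¬ n < k := by omega
      have h2 : ¬ n + 1 < k := by omega
      have h3 : n ≠ k := by omega
      have h4 : n + 1 ≠ k := by omega
      simp only [h1, h2, h3, h4, if_false]
      exact x.2 n⟩

open Classical in
/-- The Vershik map of a properly ordered diagram: the path with only maximal edges is sent to
the path with only minimal edges, and any other path is sent to its successor. -/
noncomputable def vershik [Finite E] (x : B.PathSpace) : B.PathSpace :=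
  if h : ∃ k, ¬ IsMax (x.1 k) then B.succPath x (Nat.find h)
  else if h' : ∃ y : B.PathSpace, ∀ n, IsMin (y.1 n) then h'.choose else x

/-! ### Cylinder sets -/

/-- The cylinder set `I_{n+1}(x) = [x₁, …, x_{n+1}]`, whose terminal vertex is `src (x n)`. -/
def cylinder (x : B.PathSpace) (n : ℕ) : Set B.PathSpace :=
  {y | B.src (y.1 0) = B.src (x.1 0) ∧ ∀ i < n, y.1 i = x.1 i}

/-- The cylinder set of the minimal path from `v₀` to the vertex `v` of level `n + 1`. -/
def minCylinder (n : ℕ) (v : V) : Set B.PathSpace :=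
  {y | B.src (y.1 n) = v ∧ ∀ i < n, IsMin (y.1 i)}

/-- The cylinder set of the edge of level `1` ending at `i`. -/
def base (i : V) : Set B.PathSpace := {y | B.src (y.1 0) = i}

/-! ### The combinatorial data of the limit -/

/-- An infinite path beginning at level `1` with the finite path `w`. -/
noncomputable def through [Nonempty V] {p : ℕ} (w : Fin p → E) : B.PathSpace :=
  Classical.epsilon fun x : B.PathSpace => ∀ j : Fin p, x.1 j = w j

/-- The number `c(ef)(v)`: how often the orbit of a point that begins at level `1` with `ef`, where
`src e = i`, visits the vertex `v` of level `1` up to its first return to the vertex `i`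
(return time included, starting time excluded). -/
noncomputable def passageCount [Finite E] [Nonempty V] (i : V) (e f : E) (v : V) : ℕ :=
  Set.ncard {j : ℕ | 0 < j ∧ j ≤ entranceTime B.vershik (B.base i) 1 (B.through ![e, f]) ∧
    B.vershik^[j] (B.through ![e, f]) ∈ B.base v}

/-- `c̄(ef) = ∑_v c(ef)(v) l(v)`. -/
noncomputable def cbar [Finite E] [Fintype V] [Nonempty V] (l : V → ℝ) (i : V) (ef : E × E) : ℝ :=
  ∑ v, (B.passageCount i ef.1 ef.2 v : ℝ) * l v

/-- The pair `e₁^{(k+1)} e₂^{(k+1)}`: the first two edges, after the vertex `i` of level `1`,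
of the `k`-th return to `i` of a point that begins at level `1` with the path `w` from `i`. -/
noncomputable def returnPair [Finite E] [Nonempty V] (i : V) (k : ℕ) {p : ℕ} (w : Fin p → E) :
    E × E :=
  let y := B.vershik^[entranceTime B.vershik (B.base i) k (B.through w)] (B.through w)
  (y.1 0, y.1 1)

/-- `lam` is the Perron eigenvalue of the incidence matrix, with positive right and left
eigenvectors `r` and `l` normalized by `∑ r = 1` and `∑ l r = 1`. -/
structure IsPerron [Fintype V] (lam : ℝ) (r l : V → ℝ) : Prop where
  right_pos : ∀ v, 0 < r v
  left_pos : ∀ v, 0 < l v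
  right_eigen : Matrix.mulVec B.incidence r = lam • r
  left_eigen : Matrix.vecMul l B.incidence = lam • l
  sum_right : ∑ v, r v = 1
  sum_left_right : ∑ v, l v * r v = 1

open Classical in
/-- The function `F_{1,…,p}(t₁, …, t_p)` with `p = q + 1` and `t_k = t (k - 1)`: the sum over all
paths `e₁ … e_{p+1}` starting at `i` of
`min (t₁⁺ / r(i), c̄(e₁e₂)) ∏_{k=2}^p 1{c̄(e₁^{(k)}e₂^{(k)}) ≤ t_k / r(i)} r(t(e_{p+1})) / lam^{p+1}`. -/
noncomputable def limitCdf [Fintype V] [Fintype E] [Nonempty V] (lam : ℝ) (r l : V → ℝ) (i : V)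
    (q : ℕ) (t : Fin (q + 1) → ℝ) : ℝ :=
  ∑ w ∈ Finset.univ.filter (fun w : Fin (q + 2) → E => B.IsPathFrom i w),
    min (max (t 0) 0 / r i) (B.cbar l i (w 0, w 1)) *
      (∏ k : Fin q,
        if B.cbar l i (B.returnPair i (k + 1) w) ≤ t k.succ / r i then (1 : ℝ) else 0) *
      (r (B.tgt (w (Fin.last (q + 1)))) / lam ^ (q + 2))

end StationaryDiagram

/-! The diagram is stationary, so the Vershik map is a skyscraper over itself. The map `tail n`
forgets the path above level `n + 1`, `pos n` is the rank of the forgotten segment among the paths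
to the same vertex, and an orbit climbs the `height n v` floors over a vertex `v` before the tail
moves by one application of `vershik` (`isTower`). A cylinder ending at level `n + 1` is exactly one
floor (`cylinder_eq`). Visits to `I_n` are therefore visits of the tail to the vertex `i*` of level
one, and a return time is the sum of the heights passed, `∑ v, c(ef)(v) * height n v`. By (H1) every
tower over a vertex of level two passes through all vertices of level one, and by (H3) the vertex
reached after a carry does not depend on the rest of the path; hence the first return time reads two
edges and each further one reads one more (`return_mem_cylinder`).

Perron theory gives the scale. Heights grow like `l v * lam ^ n` (`IsPerron.tendsto_height`), a
floor over `v` has measure exactly `r v / lam ^ n` (`IsPerron.measureReal_minCylinder`), and the law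
of the tail given `I_n` is `μ` conditioned on the vertex `i*`, whatever `n` is
(`IsPerron.map_tail_restrict`).

A `μ`-typical point does not start in `I_n`. A weighted form of Kac's formula
(`Recurrent.lintegral_gapSeq`) distributes it over the waiting times `1, …, N` below the next visit.
With mesh `(lam ^ n)⁻¹` the sum over waiting times becomes a Lebesgue integral, so the law of the
whole gap sequence is an image of `μ × Lebesgue` on a region of a space that does not depend on `n`
(`IsPerron.lintegral_gapSeq`). Regions and gaps converge almost everywhere, and dominated
convergence gives convergence in law of the entire sequence, with an explicit limit and no tightness
argument. Slicing the limit by the first edges yields `F` (`IsPerron.limitLaw_lowerBox`). After the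
first one, the limiting gaps are bounded below, so their sum diverges, and on `divergentSeq` the
point process is a vaguely continuous function of the gaps. -/

/-! ### Entrance times of recurrent sets -/

section Entrance

variable {X : Type*} {T : X → X} {I : Set X}

/-- Every forward orbit meets `I` at a positive time. -/
def Recurrent (T : X → X) (I : Set X) : Prop := ∀ x, ∃ j, 0 < j ∧ T^[j] x ∈ I

theorem Recurrent.exists_gt (h : Recurrent T I) (x : X) (m : ℕ) : ∃ n, m < n ∧ T^[n] x ∈ I := by
  obtain ⟨j, hj, hx⟩ := h (T^[m] x)
  exact ⟨j + m, by omega, by rwa [Function.iterate_add_apply]⟩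

theorem Recurrent.entranceTime_lt (h : Recurrent T I) (k : ℕ) (x : X) :
    entranceTime T I k x < entranceTime T I (k + 1) x :=
  (Nat.sInf_mem (h.exists_gt x (entranceTime T I k x))).1

theorem Recurrent.iterate_entranceTime_mem (h : Recurrent T I) (k : ℕ) (x : X) :
    T^[entranceTime T I (k + 1) x] x ∈ I :=
  (Nat.sInf_mem (h.exists_gt x (entranceTime T I k x))).2

theorem entranceTime_succ_le {k n : ℕ} {x : X} (h1 : entranceTime T I k x < n)
    (h2 : T^[n] x ∈ I) : entranceTime T I (k + 1) x ≤ n :=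
  Nat.sInf_le ⟨h1, h2⟩

theorem Recurrent.entranceTime_succ_eq (h : Recurrent T I) {k n : ℕ} {x : X}
    (h1 : entranceTime T I k x < n) (h2 : T^[n] x ∈ I)
    (h3 : ∀ j, entranceTime T I k x < j → T^[j] x ∈ I → n ≤ j) :
    entranceTime T I (k + 1) x = n :=
  le_antisymm (entranceTime_succ_le h1 h2)
    (h3 _ (h.entranceTime_lt k x) (h.iterate_entranceTime_mem k x))

theorem Recurrent.entranceTime_succ (h : Recurrent T I) (k : ℕ) (x : X) :
    entranceTime T I (k + 1) x =
      entranceTime T I k x + entranceTime T I 1 (T^[entranceTime T I k x] x) := by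
  set y := T^[entranceTime T I k x] x with hy
  refine h.entranceTime_succ_eq ?_ ?_ fun j hj hjI => ?_
  · have := h.entranceTime_lt 0 y
    have h0 : entranceTime T I 0 y = 0 := rfl
    rw [h0, zero_add] at this
    omega
  · have := h.iterate_entranceTime_mem 0 y
    rwa [hy, ← Function.iterate_add_apply, add_comm] at this
  · obtain ⟨d, rfl⟩ := Nat.exists_eq_add_of_lt hj
    have : entranceTime T I 1 y ≤ d + 1 := by
      refine entranceTime_succ_le (Nat.succ_pos d) ?_
      rw [hy, ← Function.iterate_add_apply]
      convert hjI using 2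
      omega
    omega

/-- Splitting at the first visit rather than the last is the form suited to inductions that shift
the starting point. -/
theorem Recurrent.entranceTime_succ' (h : Recurrent T I) (k : ℕ) (x : X) :
    entranceTime T I (k + 1) x =
      entranceTime T I 1 x + entranceTime T I k (T^[entranceTime T I 1 x] x) := by
  induction k with
  | zero => rfl
  | succ k ih =>
    rw [h.entranceTime_succ, ih, h.entranceTime_succ k (T^[entranceTime T I 1 x] x),
      ← Function.iterate_add_apply, add_assoc,
      add_comm (entranceTime T I k (T^[entranceTime T I 1 x] x)) (entranceTime T I 1 x)]

end Entrance

/-! ### Towers -/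

/-- `T` is a tower (skyscraper) over `S` with roof function `H`: the point `x` lies above `π x`
at height `pos x`. -/
structure IsTower {X Z : Type*} (T : X → X) (S : Z → Z) (π : X → Z) (pos : X → ℕ)
    (H : Z → ℕ) : Prop where
  roof_pos : ∀ z, 0 < H z
  pos_lt : ∀ x, pos x < H (π x)
  step : ∀ x, pos x + 1 < H (π x) → π (T x) = π x ∧ pos (T x) = pos x + 1
  top : ∀ x, pos x + 1 = H (π x) → π (T x) = S (π x) ∧ pos (T x) = 0

section Birkhoff

variable {Z : Type*} {S : Z → Z} {H : Z → ℕ} {z : Z}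

theorem birkhoffSum_add_lt {j j' p : ℕ} (hp : p < H (S^[j] z)) (hj : j < j') :
    birkhoffSum S H j z + p < birkhoffSum S H j' z := by
  have h1 : birkhoffSum S H (j + 1) z ≤ birkhoffSum S H j' z :=
    Finset.sum_le_sum_of_subset (Finset.range_mono hj)
  rw [birkhoffSum_succ] at h1
  omega

/-- The blocks of heights occupied by successive towers are disjoint, so an absolute height
determines the tower. -/
theorem birkhoffSum_add_inj {j j' p p' : ℕ} (hp : p < H (S^[j] z)) (hp' : p' < H (S^[j'] z))
    (h : birkhoffSum S H j z + p = birkhoffSum S H j' z + p') : j = j' := by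
  rcases lt_trichotomy j j' with hj | hj | hj
  · have := birkhoffSum_add_lt hp hj; omega
  · exact hj
  · have := birkhoffSum_add_lt hp' hj; omega

end Birkhoff

namespace IsTower

variable {X Z : Type*} {T : X → X} {S : Z → Z} {π : X → Z} {pos : X → ℕ} {H : Z → ℕ}

/-- The absolute height, floor plus the roofs of the towers already climbed, grows by one with each
application of `T`. -/
theorem exists_iterate (h : IsTower T S π pos H) (x : X) (i : ℕ) :
    ∃ j, pos (T^[i] x) + birkhoffSum S H j (π x) = pos x + i ∧ π (T^[i] x) = S^[j] (π x) := by
  induction i with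
  | zero => exact ⟨0, by simp, rfl⟩
  | succ i ih =>
    obtain ⟨j, h1, h2⟩ := ih
    rw [Function.iterate_succ_apply']
    have hlt := h.pos_lt (T^[i] x)
    rcases Nat.lt_or_eq_of_le (Nat.succ_le_of_lt hlt) with hs | hs
    · obtain ⟨h3, h4⟩ := h.step _ hs
      exact ⟨j, by omega, h3.trans h2⟩
    · obtain ⟨h3, h4⟩ := h.top _ hs
      refine ⟨j + 1, ?_, by rw [h3, h2, Function.iterate_succ_apply']⟩
      rw [birkhoffSum_succ, ← h2]
      omega

theorem iterate_eq (h : IsTower T S π pos H) {x : X} {i j p : ℕ} (hp : p < H (S^[j] (π x)))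
    (hi : pos x + i = birkhoffSum S H j (π x) + p) :
    π (T^[i] x) = S^[j] (π x) ∧ pos (T^[i] x) = p := by
  obtain ⟨j', h1, h2⟩ := h.exists_iterate x i
  have h3 := h.pos_lt (T^[i] x)
  rw [h2] at h3
  have : j' = j := birkhoffSum_add_inj h3 hp (by omega)
  subst this
  exact ⟨h2, by omega⟩

/-- Visit times to a floor are partial sums of roofs, shifted by the starting floor and the target
floor; entrance times and visit counts both come from this. -/
theorem iterate_mem_iff (h : IsTower T S π pos H) {C : Set Z} {p : ℕ} (hC : ∀ z ∈ C, p < H z)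
    (x : X) (i : ℕ) :
    T^[i] x ∈ {y | π y ∈ C ∧ pos y = p} ↔
      ∃ j, S^[j] (π x) ∈ C ∧ pos x + i = birkhoffSum S H j (π x) + p := by
  constructor
  · rintro ⟨h1, h2⟩
    obtain ⟨j, h3, h4⟩ := h.exists_iterate x i
    exact ⟨j, h4 ▸ h1, by omega⟩
  · rintro ⟨j, h1, h2⟩
    obtain ⟨h3, h4⟩ := h.iterate_eq (hC _ h1) h2
    exact ⟨h3 ▸ h1, h4⟩

theorem recurrent (h : IsTower T S π pos H) {C : Set Z} {p : ℕ} (hC : ∀ z ∈ C, p < H z)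
    (hS : Recurrent S C) : Recurrent T {y | π y ∈ C ∧ pos y = p} := by
  intro x
  obtain ⟨j, hj, hjC⟩ := hS (π x)
  have h1 := birkhoffSum_add_lt (S := S) (z := π x) (j := 0) (h.pos_lt x) hj
  rw [birkhoffSum_zero] at h1
  exact ⟨birkhoffSum S H j (π x) + p - pos x, by omega,
    (h.iterate_mem_iff hC x _).2 ⟨j, hjC, by omega⟩⟩

theorem entranceTime_eq (h : IsTower T S π pos H) {C : Set Z} {p : ℕ} (hC : ∀ z ∈ C, p < H z)
    (hS : Recurrent S C) {x : X} (hx : pos x = p) (k : ℕ) :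
    entranceTime T {y | π y ∈ C ∧ pos y = p} k x =
      birkhoffSum S H (entranceTime S C k (π x)) (π x) := by
  induction k with
  | zero => simp [entranceTime]
  | succ k ih =>
    refine (h.recurrent hC hS).entranceTime_succ_eq ?_ ?_ fun i hi hiA => ?_
    · rw [ih]
      simpa using birkhoffSum_add_lt (h.roof_pos _) (hS.entranceTime_lt k (π x))
    · exact (h.iterate_mem_iff hC x _).2 ⟨_, hS.iterate_entranceTime_mem k _, by omega⟩
    · obtain ⟨j, hj, hij⟩ := (h.iterate_mem_iff hC x i).1 hiA
      have hi' : i = birkhoffSum S H j (π x) := by omega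
      rw [hi']
      refine Finset.sum_le_sum_of_subset (Finset.range_mono (entranceTime_succ_le ?_ hj))
      rw [ih, hi'] at hi
      by_contra! hle
      exact absurd hi (not_lt.2 (Finset.sum_le_sum_of_subset (Finset.range_mono hle)))

theorem iterate_entranceTime (h : IsTower T S π pos H) {C : Set Z} {p : ℕ}
    (hC : ∀ z ∈ C, p < H z) (hS : Recurrent S C) {x : X} (hx : pos x = p) (hxC : π x ∈ C)
    (k : ℕ) :
    π (T^[entranceTime T {y | π y ∈ C ∧ pos y = p} k x] x) =
        S^[entranceTime S C k (π x)] (π x) ∧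
      pos (T^[entranceTime T {y | π y ∈ C ∧ pos y = p} k x] x) = p := by
  refine h.iterate_eq (hC _ ?_) (by rw [h.entranceTime_eq hC hS hx, hx, add_comm])
  cases k with
  | zero => exact hxC
  | succ k => exact hS.iterate_entranceTime_mem k _

/-- Each passage of `S` through `D` is one visit of `T` to a bottom floor. The bottom of the
starting tower lies at or before time `0` and is excluded, that of the arrival tower lies at or
before the stopping time and is counted; this matches `0 < j ≤ N` downstairs. -/
theorem ncard_visits (h : IsTower T S π pos H) {C D : Set Z} {p : ℕ}
    (hC : ∀ z ∈ C, p < H z) (hS : Recurrent S C) {x : X} (hx : pos x = p) :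
    Set.ncard {i : ℕ | 0 < i ∧ i ≤ entranceTime T {y | π y ∈ C ∧ pos y = p} 1 x ∧
        T^[i] x ∈ {y | π y ∈ D ∧ pos y = 0}} =
      Set.ncard {j : ℕ | 0 < j ∧ j ≤ entranceTime S C 1 (π x) ∧ S^[j] (π x) ∈ D} := by
  have hpos : ∀ j, 0 < j → p < birkhoffSum S H j (π x) := fun j hj => by
    have := birkhoffSum_add_lt (S := S) (z := π x) (j := 0) (h.pos_lt x) hj
    rw [birkhoffSum_zero] at this
    omega
  have hmem := hC _ (hS.iterate_entranceTime_mem 0 (π x))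
  rw [zero_add] at hmem
  rw [h.entranceTime_eq hC hS hx]
  symm
  refine Set.ncard_congr (fun j _ => birkhoffSum S H j (π x) - p) ?_ ?_ ?_
  · rintro j ⟨hj0, hjN, hjD⟩
    have h1 := hpos j hj0
    have h2 : birkhoffSum S H j (π x) ≤ birkhoffSum S H (entranceTime S C 1 (π x)) (π x) :=
      Finset.sum_le_sum_of_subset (Finset.range_mono hjN)
    exact ⟨by omega, by omega,
      (h.iterate_mem_iff (fun z _ => h.roof_pos z) x _).2 ⟨j, hjD, by omega⟩⟩
  · rintro j j' ⟨hj, -⟩ ⟨hj', -⟩ heq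
    have h1 := hpos j hj
    have h2 := hpos j' hj'
    exact birkhoffSum_add_inj (S := S) (z := π x) (h.roof_pos _) (h.roof_pos _)
      (by omega)
  · rintro i ⟨hi0, hiN, hiD⟩
    obtain ⟨j, hjD, hj⟩ := (h.iterate_mem_iff (fun z _ => h.roof_pos z) x i).1 hiD
    refine ⟨j, ⟨?_, ?_, hjD⟩, by omega⟩
    · rcases Nat.eq_zero_or_pos j with rfl | hj0
      · rw [birkhoffSum_zero] at hj
        omega
      · exact hj0
    · by_contra! hlt
      have := birkhoffSum_add_lt hmem hlt
      omega

end IsTower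

namespace StationaryDiagram

/-! ### The Vershik map as a tower over itself -/

section Tower

variable {V E : Type*} [PartialOrder E] (B : StationaryDiagram V E)

/-- The part of a path below level `n + 1`, again an infinite path by stationarity. -/
def tail (n : ℕ) (x : B.PathSpace) : B.PathSpace := ⟨fun j => x.1 (n + j), fun j => x.2 (n + j)⟩

@[simp]
theorem tail_apply (n : ℕ) (x : B.PathSpace) (j : ℕ) : (B.tail n x).1 j = x.1 (n + j) := rfl

theorem tail_succ (n : ℕ) (x : B.PathSpace) : B.tail (n + 1) x = B.tail 1 (B.tail n x) :=
  Subtype.ext (funext fun j => by simp [add_assoc])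

theorem tail_zero (x : B.PathSpace) : B.tail 0 x = x :=
  Subtype.ext (funext fun j => by simp)

variable {B}

theorem src_eq_of_mem_cylinder {n : ℕ} {x y : B.PathSpace} (h : y ∈ B.cylinder x n) :
    B.src (y.1 n) = B.src (x.1 n) := by
  cases n with
  | zero => exact h.1
  | succ n => rw [← x.2 n, ← y.2 n, h.2 n (Nat.lt_succ_self n)]

theorem cylinder_anti {x y : B.PathSpace} {m n : ℕ} (h : y ∈ B.cylinder x n) (hmn : m ≤ n) :
    y ∈ B.cylinder x m := ⟨h.1, fun i hi => h.2 i (hi.trans_le hmn)⟩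

theorem tail_mem_cylinder {x y : B.PathSpace} {n : ℕ} (h : y ∈ B.cylinder x (n + 1)) :
    B.tail 1 y ∈ B.cylinder (B.tail 1 x) n :=
  ⟨by
    have := src_eq_of_mem_cylinder (cylinder_anti h (Nat.le_add_left 1 n))
    simpa using this, fun i hi => h.2 _ (by omega)⟩

theorem mem_cylinder_succ {x y : B.PathSpace} {n : ℕ} (h0 : y.1 0 = x.1 0)
    (h : B.tail 1 y ∈ B.cylinder (B.tail 1 x) n) : y ∈ B.cylinder x (n + 1) := by
  refine ⟨congrArg B.src h0, fun i hi => ?_⟩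
  cases i with
  | zero => exact h0
  | succ i => simpa [add_comm] using h.2 i (by omega)

theorem le_or_le {e f : E} (h : B.tgt e = B.tgt f) : e ≤ f ∨ f ≤ e := (B.comparable_iff e f).2 h

theorem tgt_eq_of_le {e f : E} (h : e ≤ f) : B.tgt e = B.tgt f :=
  (B.comparable_iff e f).1 (Or.inl h)

variable [Finite E]

theorem isMin_minEdge (v : V) : IsMin (B.minEdge v) := (B.exists_minEdge v).choose_spec.2

theorem eq_minEdge {e : E} (he : IsMin e) : e = B.minEdge (B.tgt e) := by
  rcases le_or_le (B := B) (B.tgt_minEdge (B.tgt e)).symm with h | h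
  · exact h.antisymm (isMin_minEdge _ h)
  · exact (he h).antisymm h

theorem covBy_succEdge {e : E} (he : ¬ IsMax e) : e ⋖ succEdge e := by
  have h : ∃ f, e ⋖ f := exists_covBy_of_wellFoundedLT he
  rw [succEdge, dif_pos h]
  exact h.choose_spec

theorem succPath_apply (x : B.PathSpace) (k j : ℕ) :
    (B.succPath x k).1 j = if j < k then B.descend (B.src (succEdge (x.1 k))) (k - 1 - j)
      else if j = k then succEdge (x.1 k) else x.1 j := rfl

open Classical in
theorem vershik_of_not_isMax {x : B.PathSpace} (h : ¬ IsMax (x.1 0)) :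
    (B.vershik x).1 0 = succEdge (x.1 0) ∧ B.tail 1 (B.vershik x) = B.tail 1 x := by
  have hex : ∃ k, ¬ IsMax (x.1 k) := ⟨0, h⟩
  have h0 : Nat.find hex = 0 := (Nat.find_eq_zero hex).2 h
  have hV : B.vershik x = B.succPath x 0 := by rw [vershik, dif_pos hex, h0]
  rw [hV]
  refine ⟨by simp [succPath_apply], Subtype.ext (funext fun j => ?_)⟩
  simp [succPath_apply]

open Classical in
-- The carry of an odometer: the map acts on the tail and a minimal edge is put in front. The
-- maximal path is included because its image, the minimal path, equals its own tail by uniqueness.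
theorem vershik_of_isMax (hB : B.ProperlyOrdered) {x : B.PathSpace} (h : IsMax (x.1 0)) :
    (B.vershik x).1 0 = B.minEdge (B.src ((B.vershik (B.tail 1 x)).1 0)) ∧
      B.tail 1 (B.vershik x) = B.vershik (B.tail 1 x) := by
  by_cases hex : ∃ k, ¬ IsMax (x.1 k)
  · obtain ⟨k, hk⟩ : ∃ k, Nat.find hex = k + 1 := by
      refine Nat.exists_eq_succ_of_ne_zero fun h0 => ?_
      exact (h0 ▸ Nat.find_spec hex) h
    have hex' : ∃ k, ¬ IsMax ((B.tail 1 x).1 k) := ⟨k, by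
      have := Nat.find_spec hex
      rwa [hk, add_comm] at this⟩
    have hk' : Nat.find hex' = k := by
      rw [Nat.find_eq_iff]
      refine ⟨?_, fun m hm => ?_⟩
      · have := Nat.find_spec hex
        rwa [hk, add_comm] at this
      · have := Nat.find_min hex (m := m + 1) (by omega)
        rwa [add_comm] at this
    have hV : B.vershik x = B.succPath x (k + 1) := by rw [vershik, dif_pos hex, hk]
    have hV' : B.vershik (B.tail 1 x) = B.succPath (B.tail 1 x) k := by
      rw [vershik, dif_pos hex', hk']
    rw [hV, hV']
    constructor
    · rcases k with - | k
      · simp [succPath_apply, descend]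
      · simp [succPath_apply, descend, add_comm]
    · refine Subtype.ext (funext fun j => ?_)
      have h1 : k + 1 - 1 - (1 + j) = k - 1 - j := by omega
      have h2 : 1 + j < k + 1 ↔ j < k := by omega
      have h3 : 1 + j = k + 1 ↔ j = k := by omega
      have h4 : k + 1 = 1 + k := by omega
      simp only [tail_apply, succPath_apply, h1, h2, h3]
      simp only [h4]
  · have hex' : ¬ ∃ k, ¬ IsMax ((B.tail 1 x).1 k) := by
      push Not at hex ⊢
      exact fun k => hex _
    have hy := hB.2.exists
    have hV : B.vershik x = hy.choose := by rw [vershik, dif_neg hex, dif_pos hy]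
    have hV' : B.vershik (B.tail 1 x) = hy.choose := by rw [vershik, dif_neg hex', dif_pos hy]
    have hmin := hy.choose_spec
    have htail : B.tail 1 hy.choose = hy.choose := hB.2.unique (fun n => hmin _) hmin
    rw [hV, hV']
    refine ⟨?_, htail⟩
    refine (eq_minEdge (B := B) (hmin 0)).trans ?_
    rw [hy.choose.2 0]
    conv_rhs => rw [← htail]
    rfl

theorem src_vershik_of_isMax (hB : B.ProperlyOrdered) {one : V}
    (H3 : ∀ e : E, IsMin e → B.src e = one) {x : B.PathSpace} (h : IsMax (x.1 0)) :
    B.src ((B.vershik x).1 0) = one := by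
  rw [(vershik_of_isMax hB h).1]
  exact H3 _ (isMin_minEdge _)

end Tower

/-! ### Heights of the towers and ranks of initial segments. -/

section Heights

variable {V E : Type*} [Fintype E] [PartialOrder E] (B : StationaryDiagram V E)

open Classical in
/-- The number of paths from `v₀` to the vertex `v` of level `n + 1`. -/
noncomputable def height : ℕ → V → ℕ
  | 0, _ => 1
  | n + 1, v => ∑ e : E with B.tgt e = v, height n (B.src e)

open Classical in
/-- The number of paths from `v₀` to level `n + 2` whose last edge precedes `e`. -/
noncomputable def below (n : ℕ) (e : E) : ℕ := ∑ f : E with f < e, B.height n (B.src f)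

/-- The number of paths from `v₀` to level `n + 1` that precede the beginning of `y`. -/
noncomputable def pos : ℕ → B.PathSpace → ℕ
  | 0, _ => 0
  | n + 1, y => pos n y + B.below n (y.1 n)

variable {B}

theorem height_pos (n : ℕ) (v : V) : 0 < B.height n v := by
  induction n generalizing v with
  | zero => exact Nat.one_pos
  | succ n ih =>
    obtain ⟨e, he⟩ := B.exists_tgt v
    exact Finset.sum_pos (fun e _ => ih _) ⟨e, by simp [he]⟩

/-- Each edge into a vertex owns an interval of ranks, as long as the height of its source; these
intervals are disjoint and ordered like the edges. -/
theorem below_add_le {n : ℕ} {e f : E} (h : e < f) :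
    B.below n e + B.height n (B.src e) ≤ B.below n f := by
  classical
  have he : e ∉ Finset.univ.filter (fun g => g < e) := by simp
  rw [below, below, add_comm, ← Finset.sum_insert (f := fun g => B.height n (B.src g)) he]
  refine Finset.sum_le_sum_of_subset fun g hg => ?_
  simp only [Finset.mem_insert, Finset.mem_filter, Finset.mem_univ, true_and] at hg ⊢
  rcases hg with rfl | hg
  · exact h
  · exact hg.trans h

theorem below_succEdge {n : ℕ} {e : E} (h : ¬ IsMax e) :
    B.below n (succEdge e) = B.below n e + B.height n (B.src e) := by
  classical
  have he : e ∉ Finset.univ.filter (fun g => g < e) := by simp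
  have hc := covBy_succEdge h
  rw [below, below, add_comm, ← Finset.sum_insert (f := fun g => B.height n (B.src g)) he]
  refine Finset.sum_congr (Finset.ext fun g => ?_) fun _ _ => rfl
  simp only [Finset.mem_insert, Finset.mem_filter, Finset.mem_univ, true_and]
  refine ⟨fun hg => ?_, ?_⟩
  · rcases le_or_le (B := B) ((tgt_eq_of_le hg.le).trans (tgt_eq_of_le hc.le).symm) with h1 | h1
    · exact h1.eq_or_lt
    · exact (h1.eq_or_lt.imp Eq.symm fun h2 => absurd hg (hc.2 h2))
  · rintro (rfl | hg)
    exacts [hc.lt, hg.trans hc.lt]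

theorem below_add_of_isMax {n : ℕ} {e : E} (h : IsMax e) :
    B.below n e + B.height n (B.src e) = B.height (n + 1) (B.tgt e) := by
  classical
  have he : e ∉ Finset.univ.filter (fun g => g < e) := by simp
  rw [below, height, add_comm, ← Finset.sum_insert (f := fun g => B.height n (B.src g)) he]
  refine Finset.sum_congr (Finset.ext fun g => ?_) fun _ _ => rfl
  simp only [Finset.mem_insert, Finset.mem_filter, Finset.mem_univ, true_and]
  refine ⟨?_, fun hg => ?_⟩
  · rintro (rfl | hg)
    exacts [rfl, tgt_eq_of_le hg.le]
  · rcases le_or_le hg with h1 | h1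
    · exact h1.eq_or_lt
    · exact Or.inl ((h h1).antisymm h1)

theorem below_add_le_height (n : ℕ) (e : E) :
    B.below n e + B.height n (B.src e) ≤ B.height (n + 1) (B.tgt e) := by
  classical
  have he : e ∉ Finset.univ.filter (fun g => g < e) := by simp
  rw [below, height, add_comm, ← Finset.sum_insert (f := fun g => B.height n (B.src g)) he]
  refine Finset.sum_le_sum_of_subset fun g hg => ?_
  simp only [Finset.mem_insert, Finset.mem_filter, Finset.mem_univ, true_and] at hg ⊢
  rcases hg with rfl | hg
  exacts [rfl, tgt_eq_of_le hg.le]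

theorem below_of_isMin {n : ℕ} {e : E} (h : IsMin e) : B.below n e = 0 := by
  classical
  refine Finset.sum_eq_zero fun g hg => absurd (Finset.mem_filter.1 hg).2 (h.not_lt)

theorem isMin_of_below_eq_zero {n : ℕ} {e : E} (h : B.below n e = 0) : IsMin e := by
  intro f hf
  by_contra hfe
  have := below_add_le (B := B) (n := n) (lt_of_le_not_ge hf hfe)
  have := height_pos (B := B) n (B.src f)
  omega

/-- A tower of level `n + 2` is a stack of towers of level `n + 1`, one for each edge into its
vertex. At the top of a block a non-maximal edge leads to the next block, while a maximal edge ends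
the whole tower and carries to the tail. -/
theorem isTower (hB : B.ProperlyOrdered) (n : ℕ) :
    IsTower B.vershik B.vershik (B.tail n) (B.pos n)
      (fun z => B.height n (B.src (z.1 0))) := by
  induction n with
  | zero =>
    refine ⟨fun _ => Nat.one_pos, fun _ => Nat.one_pos, fun x h => ?_, fun x _ => ?_⟩
    · exact absurd h (by simp [height])
    · exact ⟨by rw [tail_zero, tail_zero], rfl⟩
  | succ n ih =>
    have htgt : ∀ x : B.PathSpace, B.src ((B.tail (n + 1) x).1 0) = B.tgt (x.1 n) :=
      fun x => (x.2 n).symm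
    have hlt : ∀ x : B.PathSpace, B.pos n x < B.height n (B.src (x.1 n)) := ih.pos_lt
    refine ⟨fun _ => height_pos _ _, fun x => ?_, fun x h => ?_, fun x h => ?_⟩
    · rw [htgt, pos]
      have := below_add_le_height (B := B) n (x.1 n)
      have := hlt x
      omega
    · rcases Nat.lt_or_eq_of_le (Nat.succ_le_of_lt (ih.pos_lt x)) with hs | hs
      · obtain ⟨h1, h2⟩ := ih.step x hs
        have h3 : (B.vershik x).1 n = x.1 n := congrArg (fun z : B.PathSpace => z.1 0) h1
        refine ⟨by rw [tail_succ, h1, ← tail_succ], ?_⟩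
        rw [pos, pos, h3, h2]
        omega
      · obtain ⟨h1, h2⟩ := ih.top x hs
        have hs : B.pos n x + 1 = B.height n (B.src (x.1 n)) := hs
        have h3 : (B.vershik x).1 n = (B.vershik (B.tail n x)).1 0 :=
          congrArg (fun z : B.PathSpace => z.1 0) h1
        -- Top of a block but not of the tower: with a maximal edge the block would be the last one.
        have hmax : ¬ IsMax ((B.tail n x).1 0) := fun hmax => by
          have := below_add_of_isMax (B := B) (n := n) (e := x.1 n) hmax
          rw [htgt, pos] at h
          omega
        obtain ⟨h4, h5⟩ := vershik_of_not_isMax hmax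
        refine ⟨by rw [tail_succ, h1, h5, ← tail_succ], ?_⟩
        rw [pos, pos, h3, h4, h2, tail_apply, add_zero, below_succEdge (e := x.1 n) hmax]
        omega
    · rw [htgt, pos] at h
      have hlt := hlt x
      have hle := below_add_le_height (B := B) n (x.1 n)
      have hs : B.pos n x + 1 = B.height n (B.src (x.1 n)) := by omega
      obtain ⟨h1, h2⟩ := ih.top x hs
      have h3 : (B.vershik x).1 n = (B.vershik (B.tail n x)).1 0 :=
        congrArg (fun z : B.PathSpace => z.1 0) h1
      -- At the top of the tower a successor edge would add one more nonempty block above.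
      have hmax : IsMax ((B.tail n x).1 0) := by
        by_contra hmax
        have h6 := below_add_le_height (B := B) n (succEdge (x.1 n))
        have h7 := height_pos (B := B) n (B.src (succEdge (x.1 n)))
        rw [below_succEdge (e := x.1 n) hmax, B.tgt_succEdge] at h6
        omega
      obtain ⟨h4, h5⟩ := vershik_of_isMax hB hmax
      refine ⟨by rw [tail_succ, h1, h5, ← tail_succ], ?_⟩
      rw [pos, h3, h4, h2, below_of_isMin (isMin_minEdge _)]

theorem eq_of_below_eq {n : ℕ} {e f : E} (ht : B.tgt e = B.tgt f) {p q : ℕ}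
    (hp : p < B.height n (B.src e)) (hq : q < B.height n (B.src f))
    (h : p + B.below n e = q + B.below n f) : e = f := by
  rcases le_or_le ht with hle | hle
  · rcases hle.eq_or_lt with h1 | h1
    · exact h1
    · have := below_add_le (B := B) (n := n) h1
      omega
  · rcases hle.eq_or_lt with h1 | h1
    · exact h1.symm
    · have := below_add_le (B := B) (n := n) h1
      omega

theorem pos_lt (hB : B.ProperlyOrdered) (n : ℕ) (x : B.PathSpace) :
    B.pos n x < B.height n (B.src (x.1 n)) := (isTower hB n).pos_lt x

theorem eq_of_pos_eq (hB : B.ProperlyOrdered) {n : ℕ} {x y : B.PathSpace}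
    (h : B.pos n y = B.pos n x) (hs : B.src (y.1 n) = B.src (x.1 n)) :
    B.src (y.1 0) = B.src (x.1 0) ∧ ∀ i < n, y.1 i = x.1 i := by
  induction n with
  | zero => exact ⟨hs, fun i hi => absurd hi (Nat.not_lt_zero i)⟩
  | succ n ih =>
    rw [pos, pos] at h
    have he : y.1 n = x.1 n :=
      eq_of_below_eq ((y.2 n).trans (hs.trans (x.2 n).symm)) (pos_lt hB n y) (pos_lt hB n x) h
    obtain ⟨h1, h2⟩ := ih (by rw [he] at h; omega) (congrArg B.src he)
    refine ⟨h1, fun i hi => ?_⟩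
    rcases Nat.lt_succ_iff_lt_or_eq.1 hi with hi | rfl
    exacts [h2 i hi, he]

theorem pos_congr {n : ℕ} {x y : B.PathSpace} (h : ∀ i < n, y.1 i = x.1 i) :
    B.pos n y = B.pos n x := by
  induction n with
  | zero => rfl
  | succ n ih =>
    rw [pos, pos, ih fun i hi => h i (Nat.lt_succ_of_lt hi), h n (Nat.lt_succ_self n)]

/-- Rank and terminal vertex determine an initial segment, so a cylinder is a single floor and the
tower lemmas apply to it. -/
theorem cylinder_eq (hB : B.ProperlyOrdered) (x : B.PathSpace) (n : ℕ) :
    B.cylinder x n =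
      {y | B.tail n y ∈ B.base (B.src (x.1 n)) ∧ B.pos n y = B.pos n x} := by
  ext y
  exact ⟨fun h => ⟨src_eq_of_mem_cylinder h, pos_congr h.2⟩, fun h => eq_of_pos_eq hB h.2 h.1⟩

theorem pos_eq_zero_iff {n : ℕ} {y : B.PathSpace} : B.pos n y = 0 ↔ ∀ i < n, IsMin (y.1 i) := by
  induction n with
  | zero => simp [pos]
  | succ n ih =>
    rw [pos, Nat.add_eq_zero_iff, ih]
    refine ⟨fun h i hi => ?_, fun h => ⟨fun i hi => h i (by omega), below_of_isMin (h n (by omega))⟩⟩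
    rcases Nat.lt_succ_iff_lt_or_eq.1 hi with hi | rfl
    exacts [h.1 i hi, isMin_of_below_eq_zero h.2]

theorem minCylinder_eq (n : ℕ) (v : V) :
    B.minCylinder n v = {y | B.tail n y ∈ B.base v ∧ B.pos n y = 0} := by
  ext y
  exact and_congr Iff.rfl pos_eq_zero_iff.symm

end Heights

/-! ### Returns to a vertex of level one -/

section Returns

variable {V E : Type*} [Fintype E] [PartialOrder E] {B : StationaryDiagram V E}

/-- The rest of the current tower and the whole next one suffice, since by (H1) the next tower
contains a floor for every vertex of level one. -/
theorem exists_visit (hB : B.ProperlyOrdered) (H1 : ∀ i j : V, ∃ e : E, B.src e = i ∧ B.tgt e = j)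
    (v : V) (z : B.PathSpace) :
    ∃ i, 0 < i ∧ B.pos 1 z + i <
        birkhoffSum B.vershik (fun z => B.height 1 (B.src (z.1 0))) 2 (B.tail 1 z) ∧
      B.vershik^[i] z ∈ B.base v := by
  have hT := isTower hB 1
  obtain ⟨e, he, het⟩ := H1 v (B.src ((B.vershik (B.tail 1 z)).1 0))
  have hp : B.below 0 e + 1 ≤ B.height 1 (B.src ((B.vershik (B.tail 1 z)).1 0)) := by
    rw [← het]
    exact below_add_le_height 0 e
  have hz : B.pos 1 z < B.height 1 (B.src ((B.tail 1 z).1 0)) := hT.pos_lt z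
  obtain ⟨h1, h2⟩ := hT.iterate_eq (x := z) (j := 1) (p := B.below 0 e)
    -- The remaining floors of the current tower, then the floor of `e` in the next one.
    (i := B.height 1 (B.src ((B.tail 1 z).1 0)) - B.pos 1 z + B.below 0 e) hp
    (by rw [birkhoffSum_one]; omega)
  refine ⟨B.height 1 (B.src ((B.tail 1 z).1 0)) - B.pos 1 z + B.below 0 e, by omega, ?_, ?_⟩
  · rw [birkhoffSum_succ, birkhoffSum_one, Function.iterate_one]
    omega
  · set y := B.vershik^[B.height 1 (B.src ((B.tail 1 z).1 0)) - B.pos 1 z + B.below 0 e] z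
    have hy : y.1 0 = e := by
      -- At index `0` all heights are `1`, so the rank among the edges to a given vertex already
      -- identifies the edge.
      refine eq_of_below_eq (B := B) (n := 0) (p := 0) (q := 0) ?_ Nat.one_pos Nat.one_pos ?_
      · rw [het, y.2 0]
        exact congrArg (fun z : B.PathSpace => B.src (z.1 0)) h1
      · rw [← h2]
        simp [pos]
    exact (congrArg B.src hy).trans he

theorem recurrent_base (hB : B.ProperlyOrdered)
    (H1 : ∀ i j : V, ∃ e : E, B.src e = i ∧ B.tgt e = j) (v : V) :
    Recurrent B.vershik (B.base v) := fun z =>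
  let ⟨i, h0, _, h⟩ := exists_visit hB H1 v z
  ⟨i, h0, h⟩

/-- A carry may run arbitrarily far, and only (H3) tells where the image starts: every carry puts a
minimal edge first, whose source is `one`. Hence just one edge of information is lost. -/
theorem vershik_mem_cylinder (hB : B.ProperlyOrdered) {one : V}
    (H3 : ∀ e : E, IsMin e → B.src e = one) {m : ℕ} {x y : B.PathSpace}
    (h : y ∈ B.cylinder x (m + 1)) : B.vershik y ∈ B.cylinder (B.vershik x) m := by
  induction m generalizing x y with
  | zero =>
    refine ⟨?_, fun i hi => absurd hi (Nat.not_lt_zero i)⟩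
    have h0 := h.2 0 Nat.one_pos
    by_cases hx : IsMax (x.1 0)
    · rw [src_vershik_of_isMax hB H3 hx, src_vershik_of_isMax hB H3 (h0 ▸ hx)]
    · rw [(vershik_of_not_isMax hx).1, (vershik_of_not_isMax (h0 ▸ hx)).1, h0]
  | succ m ih =>
    have h0 := h.2 0 (Nat.succ_pos _)
    have ht := tail_mem_cylinder h
    by_cases hx : IsMax (x.1 0)
    · obtain ⟨h1, h2⟩ := vershik_of_isMax hB hx
      obtain ⟨h3, h4⟩ := vershik_of_isMax hB (x := y) (h0 ▸ hx)
      have := ih ht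
      exact mem_cylinder_succ (by rw [h1, h3, this.1]) (by rwa [h2, h4])
    · obtain ⟨h1, h2⟩ := vershik_of_not_isMax hx
      obtain ⟨h3, h4⟩ := vershik_of_not_isMax (x := y) (h0 ▸ hx)
      exact mem_cylinder_succ (by rw [h1, h3, h0])
        (by rw [h2, h4]; exact cylinder_anti ht (Nat.le_succ m))

/-- Within two consecutive towers the tail moves at most once, so the loss of one edge does not
accumulate with `i`. -/
theorem iterate_mem_cylinder (hB : B.ProperlyOrdered) {one : V}
    (H3 : ∀ e : E, IsMin e → B.src e = one) {m i : ℕ} {x y : B.PathSpace}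
    (h : y ∈ B.cylinder x (m + 2))
    (hi : B.pos 1 x + i <
      birkhoffSum B.vershik (fun z => B.height 1 (B.src (z.1 0))) 2 (B.tail 1 x)) :
    B.vershik^[i] y ∈ B.cylinder (B.vershik^[i] x) (m + 1) := by
  have hT := isTower hB 1
  have h0 := h.2 0 (Nat.succ_pos _)
  have ht := tail_mem_cylinder h
  have hpos : B.pos 1 y = B.pos 1 x := by simp [pos, h0]
  obtain ⟨j, h1, h2⟩ := hT.exists_iterate x i
  have hj : j < 2 := by
    by_contra! hj
    have : birkhoffSum B.vershik (fun z => B.height 1 (B.src (z.1 0))) 2 (B.tail 1 x) ≤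
        birkhoffSum B.vershik (fun z => B.height 1 (B.src (z.1 0))) j (B.tail 1 x) :=
      Finset.sum_le_sum_of_subset (Finset.range_mono hj)
    omega
  have hc : B.vershik^[j] (B.tail 1 y) ∈ B.cylinder (B.vershik^[j] (B.tail 1 x)) m := by
    interval_cases j
    · exact cylinder_anti ht (Nat.le_succ m)
    · exact vershik_mem_cylinder hB H3 ht
  have hΘ : birkhoffSum B.vershik (fun z => B.height 1 (B.src (z.1 0))) j (B.tail 1 y) =
      birkhoffSum B.vershik (fun z => B.height 1 (B.src (z.1 0))) j (B.tail 1 x) := by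
    interval_cases j
    · simp [birkhoffSum_zero]
    · rw [birkhoffSum_one, birkhoffSum_one, ht.1]
  have hlt := hT.pos_lt (B.vershik^[i] x)
  rw [h2] at hlt
  obtain ⟨h3, h4⟩ := hT.iterate_eq (x := y) (j := j) (p := B.pos 1 (B.vershik^[i] x)) (i := i)
    (by simpa only [hc.1] using hlt) (by rw [hpos, hΘ]; omega)
  refine mem_cylinder_succ ?_ (by rw [h2, h3]; exact hc)
  refine eq_of_below_eq (B := B) (n := 0) (p := 0) (q := 0) ?_ Nat.one_pos Nat.one_pos
    (by simpa [pos] using h4)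
  rw [(B.vershik^[i] y).2 0, (B.vershik^[i] x).2 0]
  have := hc.1
  rw [← h2, ← h3] at this
  simpa using this

/-- The first return to the vertex `v` of level `1` is a local event. -/
theorem entranceTime_one_local (hB : B.ProperlyOrdered)
    (H1 : ∀ i j : V, ∃ e : E, B.src e = i ∧ B.tgt e = j) {one : V}
    (H3 : ∀ e : E, IsMin e → B.src e = one) (v : V) {m : ℕ} {x y : B.PathSpace}
    (h : y ∈ B.cylinder x (m + 2)) :
    entranceTime B.vershik (B.base v) 1 y = entranceTime B.vershik (B.base v) 1 x ∧
      ∀ i ≤ entranceTime B.vershik (B.base v) 1 x,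
        B.vershik^[i] y ∈ B.cylinder (B.vershik^[i] x) (m + 1) := by
  have hrec := recurrent_base hB H1 v
  obtain ⟨n, hn0, hn, hnv⟩ := exists_visit hB H1 v x
  have hle : entranceTime B.vershik (B.base v) 1 x ≤ n := entranceTime_succ_le hn0 hnv
  have hloc : ∀ i ≤ entranceTime B.vershik (B.base v) 1 x,
      B.vershik^[i] y ∈ B.cylinder (B.vershik^[i] x) (m + 1) :=
    fun i hi => iterate_mem_cylinder hB H3 h (by omega)
  refine ⟨hrec.entranceTime_succ_eq (hrec.entranceTime_lt 0 x) ?_ fun j hj hjv => ?_, hloc⟩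
  · exact (hloc _ le_rfl).1.trans (hrec.iterate_entranceTime_mem 0 x)
  · by_contra! hlt
    exact absurd (entranceTime_succ_le (T := B.vershik) (I := B.base v) (k := 0) (x := x) hj
      ((hloc j hlt.le).1.symm.trans hjv)) (not_le.2 hlt)

/-- Each return costs one edge. For `m = 1` the first two edges of the `k`-th return are read off `k
+ 2` edges, which is why `p` gaps require paths `e₁ ⋯ e_{p+1}`. -/
theorem return_mem_cylinder (hB : B.ProperlyOrdered)
    (H1 : ∀ i j : V, ∃ e : E, B.src e = i ∧ B.tgt e = j) {one : V}
    (H3 : ∀ e : E, IsMin e → B.src e = one) (v : V) {k m : ℕ} {x y : B.PathSpace}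
    (h : y ∈ B.cylinder x (m + k + 1)) :
    B.vershik^[entranceTime B.vershik (B.base v) k y] y ∈
      B.cylinder (B.vershik^[entranceTime B.vershik (B.base v) k x] x) (m + 1) := by
  induction k generalizing x y with
  | zero => exact h
  | succ k ih =>
    have hrec := recurrent_base hB H1 v
    obtain ⟨h1, h2⟩ := entranceTime_one_local hB H1 H3 v (m := m + k) h
    rw [hrec.entranceTime_succ' k x, hrec.entranceTime_succ' k y, h1,
      add_comm (entranceTime _ _ 1 x), Function.iterate_add_apply,
      add_comm (entranceTime _ _ 1 x), Function.iterate_add_apply]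
    exact ih (h2 _ le_rfl)

end Returns

end StationaryDiagram

namespace StationaryDiagram

/-! ### Return times to a cylinder in terms of heights. -/

section ReturnData

variable {V E : Type*} [Fintype V] [Nonempty V] [Fintype E] [PartialOrder E]
  (B : StationaryDiagram V E)

/-- The first two edges of the `k`-th return of `z` to the vertex `i` of level `1`. -/
noncomputable def pairAt (i : V) (k : ℕ) (z : B.PathSpace) : E × E :=
  ((B.vershik^[entranceTime B.vershik (B.base i) k z] z).1 0,
    (B.vershik^[entranceTime B.vershik (B.base i) k z] z).1 1)

/-- The return time to a cylinder of level `n + 1` ending at `i`, when the cylinder is left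
through the edges `ef`. -/
noncomputable def returnHeight (i : V) (n : ℕ) (ef : E × E) : ℕ :=
  ∑ v, B.passageCount i ef.1 ef.2 v * B.height n v

variable {B}

omit [Fintype V] [Nonempty V] in
theorem pairAt_congr (hB : B.ProperlyOrdered)
    (H1 : ∀ i j : V, ∃ e : E, B.src e = i ∧ B.tgt e = j) {one : V}
    (H3 : ∀ e : E, IsMin e → B.src e = one) (i : V) {k : ℕ} {x y : B.PathSpace}
    (h : y ∈ B.cylinder x (k + 2)) : B.pairAt i k y = B.pairAt i k x := by
  rw [show k + 2 = 1 + k + 1 by omega] at h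
  have := (return_mem_cylinder hB H1 H3 i h).2
  exact Prod.ext (this 0 two_pos) (this 1 one_lt_two)

omit [Fintype V] [Fintype E] in
theorem through_apply (x : B.PathSpace) {p : ℕ} {w : Fin p → E} (hw : ∀ j : Fin p, x.1 j = w j)
    (j : Fin p) : (B.through w).1 j = w j :=
  Classical.epsilon_spec (p := fun x : B.PathSpace => ∀ j : Fin p, x.1 j = w j) ⟨x, hw⟩ j

omit [Fintype V] [Fintype E] in
theorem through_mem_cylinder (x : B.PathSpace) {p : ℕ} {w : Fin (p + 1) → E}
    (hw : ∀ j : Fin (p + 1), x.1 j = w j) : B.through w ∈ B.cylinder x (p + 1) := by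
  have h : ∀ i < p + 1, (B.through w).1 i = x.1 i := fun i hi =>
    (through_apply x hw ⟨i, hi⟩).trans (hw ⟨i, hi⟩).symm
  exact ⟨congrArg B.src (h 0 (Nat.succ_pos p)), h⟩

omit [Fintype V] in
-- By locality, the arbitrary path chosen by `through` can be replaced by any path with the same
-- first two edges.
theorem passageCount_eq (hB : B.ProperlyOrdered)
    (H1 : ∀ i j : V, ∃ e : E, B.src e = i ∧ B.tgt e = j) {one : V}
    (H3 : ∀ e : E, IsMin e → B.src e = one) (i v : V) (z : B.PathSpace) :
    B.passageCount i (z.1 0) (z.1 1) v = Set.ncard {j : ℕ | 0 < j ∧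
      j ≤ entranceTime B.vershik (B.base i) 1 z ∧ B.vershik^[j] z ∈ B.base v} := by
  have hmem : B.through ![z.1 0, z.1 1] ∈ B.cylinder z 2 :=
    through_mem_cylinder z (p := 1) (by intro j; fin_cases j <;> rfl)
  obtain ⟨h1, h2⟩ := entranceTime_one_local hB H1 H3 i (m := 0) hmem
  rw [passageCount, h1]
  congr 1
  ext j
  simp only [Set.mem_ofPred_eq]
  refine and_congr_right fun _ => and_congr_right fun hj => ?_
  simp only [base, Set.mem_ofPred_eq, (h2 j hj).1]

omit [Fintype V] in
theorem returnPair_eq_pairAt (hB : B.ProperlyOrdered)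
    (H1 : ∀ i j : V, ∃ e : E, B.src e = i ∧ B.tgt e = j) {one : V}
    (H3 : ∀ e : E, IsMin e → B.src e = one) (i : V) (z : B.PathSpace) {q k : ℕ} (hk : k ≤ q)
    {w : Fin (q + 2) → E} (hw : ∀ j : Fin (q + 2), z.1 j = w j) :
    B.returnPair i k w = B.pairAt i k z :=
  pairAt_congr hB H1 H3 i (cylinder_anti (through_mem_cylinder z (p := q + 1) hw) (by omega))

theorem birkhoffSum_entranceTime (hB : B.ProperlyOrdered)
    (H1 : ∀ i j : V, ∃ e : E, B.src e = i ∧ B.tgt e = j) {one : V}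
    (H3 : ∀ e : E, IsMin e → B.src e = one) (n : ℕ) {i : V} {z : B.PathSpace}
    (hz : z ∈ B.base i) :
    birkhoffSum B.vershik (fun z => B.height n (B.src (z.1 0)))
      (entranceTime B.vershik (B.base i) 1 z) z = B.returnHeight i n (z.1 0, z.1 1) := by
  classical
  have hN := (recurrent_base hB H1 i).iterate_entranceTime_mem 0 z
  rw [zero_add] at hN
  set N := entranceTime B.vershik (B.base i) 1 z with hNdef
  -- The orbit segment starts and ends at `i`, so dropping its first term and adding its last
  -- changes nothing; this is the counting convention of `passageCount`.
  have h1 : ∑ m ∈ Finset.range N, B.height n (B.src ((B.vershik^[m] z).1 0)) =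
      ∑ m ∈ Finset.Ico 1 (N + 1), B.height n (B.src ((B.vershik^[m] z).1 0)) := by
    have h2 := Finset.sum_range_succ (fun m => B.height n (B.src ((B.vershik^[m] z).1 0))) N
    rw [Finset.sum_range_succ'] at h2
    have h3 : B.src ((B.vershik^[N] z).1 0) = B.src ((B.vershik^[0] z).1 0) := hN.trans hz.symm
    rw [h3] at h2
    rw [Finset.sum_Ico_eq_sum_range]
    simp only [add_comm 1, Nat.add_sub_cancel]
    exact (Nat.add_right_cancel h2).symm
  rw [birkhoffSum, h1, returnHeight,
    ← Finset.sum_fiberwise _ (fun m => B.src ((B.vershik^[m] z).1 0))]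
  refine Finset.sum_congr rfl fun v _ => ?_
  rw [Finset.sum_congr rfl (g := fun _ => B.height n v)
    (fun m hm => by rw [(Finset.mem_filter.1 hm).2]), Finset.sum_const, smul_eq_mul,
    passageCount_eq hB H1 H3, ← Set.ncard_coe_finset]
  congr 2
  ext m
  simp only [Finset.coe_filter, Finset.mem_Ico, Set.mem_ofPred_eq, ← hNdef, Nat.lt_succ_iff,
    Nat.succ_le_iff, and_assoc]
  rfl

variable {x : B.PathSpace} {i : V} {n : ℕ}

omit [Fintype V] [Nonempty V] in
theorem cylinder_eq_of_src (hB : B.ProperlyOrdered) (hx : B.src (x.1 n) = i) :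
    B.cylinder x n = {y | B.tail n y ∈ B.base i ∧ B.pos n y = B.pos n x} := by
  rw [cylinder_eq hB, hx]

omit [Fintype V] [Nonempty V] in
theorem pos_lt_of_mem_base (hB : B.ProperlyOrdered) (hx : B.src (x.1 n) = i) (z : B.PathSpace)
    (hz : z ∈ B.base i) : B.pos n x < B.height n (B.src (z.1 0)) := by
  have := pos_lt hB n x
  rwa [hx, ← show B.src (z.1 0) = i from hz] at this

omit [Fintype V] [Nonempty V] in
theorem recurrent_cylinder (hB : B.ProperlyOrdered)
    (H1 : ∀ i j : V, ∃ e : E, B.src e = i ∧ B.tgt e = j) (x : B.PathSpace) (n : ℕ) :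
    Recurrent B.vershik (B.cylinder x n) := by
  rw [cylinder_eq_of_src hB rfl]
  exact (isTower hB n).recurrent (pos_lt_of_mem_base hB rfl) (recurrent_base hB H1 _)

omit [Fintype V] in
theorem ncard_passages (hB : B.ProperlyOrdered)
    (H1 : ∀ i j : V, ∃ e : E, B.src e = i ∧ B.tgt e = j) {one : V}
    (H3 : ∀ e : E, IsMin e → B.src e = one) (hx : B.src (x.1 n) = i) {y : B.PathSpace}
    (hy : y ∈ B.cylinder x n) (v : V) :
    Set.ncard {j : ℕ | 0 < j ∧ j ≤ entranceTime B.vershik (B.cylinder x n) 1 y ∧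
      B.vershik^[j] y ∈ B.minCylinder n v} = B.passageCount i (y.1 n) (y.1 (n + 1)) v := by
  rw [cylinder_eq_of_src hB hx] at hy ⊢
  rw [minCylinder_eq, (isTower hB n).ncard_visits (pos_lt_of_mem_base hB hx)
    (recurrent_base hB H1 i) hy.2]
  exact (passageCount_eq hB H1 H3 i v (B.tail n y)).symm

omit [Fintype V] [Nonempty V] in
theorem tail_iterate_entranceTime (hB : B.ProperlyOrdered)
    (H1 : ∀ i j : V, ∃ e : E, B.src e = i ∧ B.tgt e = j) (hx : B.src (x.1 n) = i)
    {y : B.PathSpace} (hy : y ∈ B.cylinder x n) (k : ℕ) :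
    B.tail n (B.vershik^[entranceTime B.vershik (B.cylinder x n) k y] y) =
        B.vershik^[entranceTime B.vershik (B.base i) k (B.tail n y)] (B.tail n y) ∧
      B.vershik^[entranceTime B.vershik (B.cylinder x n) k y] y ∈ B.cylinder x n := by
  refine ⟨?_, ?_⟩
  · rw [cylinder_eq_of_src hB hx] at hy ⊢
    exact ((isTower hB n).iterate_entranceTime (pos_lt_of_mem_base hB hx)
      (recurrent_base hB H1 i) hy.2 hy.1 k).1
  · cases k with
    | zero => exact hy
    | succ k => exact (recurrent_cylinder hB H1 x n).iterate_entranceTime_mem k y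

/-- For a start inside the cylinder, each gap depends on two edges seen by the tail at the
corresponding return; the level enters only through `returnHeight`. -/
theorem entranceTime_cylinder_succ (hB : B.ProperlyOrdered)
    (H1 : ∀ i j : V, ∃ e : E, B.src e = i ∧ B.tgt e = j) {one : V}
    (H3 : ∀ e : E, IsMin e → B.src e = one) (hx : B.src (x.1 n) = i) {y : B.PathSpace}
    (hy : y ∈ B.cylinder x n) (k : ℕ) :
    entranceTime B.vershik (B.cylinder x n) (k + 1) y =
      entranceTime B.vershik (B.cylinder x n) k y +
        B.returnHeight i n (B.pairAt i k (B.tail n y)) := by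
  rw [(recurrent_cylinder hB H1 x n).entranceTime_succ]
  obtain ⟨h1, h2⟩ := tail_iterate_entranceTime hB H1 hx hy k
  set y' := B.vershik^[entranceTime B.vershik (B.cylinder x n) k y] y
  congr 1
  rw [pairAt, ← h1]
  rw [cylinder_eq_of_src hB hx] at h2 ⊢
  rw [(isTower hB n).entranceTime_eq (pos_lt_of_mem_base hB hx) (recurrent_base hB H1 i) h2.2,
    birkhoffSum_entranceTime hB H1 H3 n h2.1]

end ReturnData

end StationaryDiagram

/-! ### Positive matrices with given Perron eigenvectors -/

section Perron

variable {V : Type*} [Fintype V] [DecidableEq V] [Nonempty V] {M : Matrix V V ℝ} {lam : ℝ}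
  {r l : V → ℝ}

open Matrix in
-- Subtract from `M` the largest multiple `δ` of the projection `P = r lᵀ` that keeps all entries
-- nonnegative. The remainder `N` satisfies `N * P = (lam - δ) • P`, so by positivity its powers are
-- `O((lam - δ) ^ n)`, while `M ^ n = N ^ n + (lam ^ n - (lam - δ) ^ n) • P`.
theorem tendsto_pow_div_pow (hM : ∀ i j, 0 < M i j) (hr : ∀ v, 0 < r v) (hl : ∀ v, 0 < l v)
    (hMr : M *ᵥ r = lam • r) (hlM : l ᵥ* M = lam • l) (hlr : ∑ v, l v * r v = 1) (i j : V) :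
    Tendsto (fun n => (M ^ n) i j / lam ^ n) atTop (𝓝 (r i * l j)) := by
  obtain ⟨p, hp⟩ := Finite.exists_min (fun p : V × V => M p.1 p.2 / (r p.1 * l p.2))
  set δ := M p.1 p.2 / (r p.1 * l p.2) with hδ
  have hδ0 : 0 < δ := div_pos (hM _ _) (mul_pos (hr _) (hl _))
  set P : Matrix V V ℝ := vecMulVec r l with hP
  have hMP : M * P = lam • P := by rw [hP, mul_vecMulVec, hMr, smul_vecMulVec]
  have hPM : P * M = lam • P := by rw [hP, vecMulVec_mul, hlM, vecMulVec_smul]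
  have hPP : P * P = P := by
    ext a b
    simp only [hP, mul_apply, vecMulVec_apply]
    calc ∑ k, r a * l k * (r k * l b) = ∑ k, r a * l b * (l k * r k) :=
          Finset.sum_congr rfl fun k _ => by ring
      _ = r a * l b := by rw [← Finset.mul_sum, hlr, mul_one]
  set N := M - δ • P with hN
  have hMN : M = N + δ • P := by rw [hN, sub_add_cancel]
  have hNP : N * P = (lam - δ) • P := by rw [hN, sub_mul, hMP, smul_mul_assoc, hPP, sub_smul]
  have hN0 : ∀ a b, 0 ≤ N a b := fun a b => by
    have := hp (a, b)
    rw [le_div_iff₀ (mul_pos (hr _) (hl _))] at this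
    simpa [hN, hP, vecMulVec_apply] using this
  have hNn0 : ∀ n a b, 0 ≤ (N ^ n) a b := by
    intro n
    induction n with
    | zero =>
      intro a b
      rw [pow_zero, one_apply]
      split_ifs <;> norm_num
    | succ n ih =>
      intro a b
      rw [pow_succ, mul_apply]
      exact Finset.sum_nonneg fun k _ => mul_nonneg (ih _ _) (hN0 _ _)
  have hNnP : ∀ n, N ^ n * P = (lam - δ) ^ n • P := by
    intro n
    induction n with
    | zero => simp
    | succ n ih => rw [pow_succ, mul_assoc, hNP, mul_smul_comm, ih, smul_smul, pow_succ, mul_comm]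
  have hMn : ∀ n, M ^ n = N ^ n + (lam ^ n - (lam - δ) ^ n) • P := by
    intro n
    induction n with
    | zero => simp
    | succ n ih =>
      rw [pow_succ, ih, add_mul, smul_mul_assoc, hPM, show N ^ n * M = N ^ n * (N + δ • P) by
        rw [← hMN], mul_add, ← pow_succ, mul_smul_comm, hNnP, smul_smul, smul_smul, add_assoc, ← add_smul]
      congr 2
      ring
  -- An entry of `N ^ n * P` is a sum of nonnegative terms, hence bounds each of them.
  have hle : ∀ n a b, (N ^ n) a b * (r b * l b) ≤ (lam - δ) ^ n * (r a * l b) := fun n a b => by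
    have h1 := congrFun (congrFun (hNnP n) a) b
    rw [mul_apply] at h1
    have h2 := Finset.single_le_sum (f := fun k => (N ^ n) a k * P k b)
      (fun k _ => mul_nonneg (hNn0 n a k) (mul_nonneg (hr k).le (hl b).le)) (Finset.mem_univ b)
    rw [h1] at h2
    simpa [hP, vecMulVec_apply] using h2
  have hδle : 0 ≤ lam - δ := by
    have h1 := hle 1 i i
    have h2 := mul_nonneg (hN0 i i) (mul_pos (hr i) (hl i)).le
    rw [pow_one, pow_one] at h1
    exact le_of_mul_le_mul_right (by linarith) (mul_pos (hr i) (hl i))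
  have hlam : 0 < lam := by linarith
  have hρ : Tendsto (fun n => ((lam - δ) / lam) ^ n) atTop (𝓝 0) :=
    tendsto_pow_atTop_nhds_zero_of_lt_one (by positivity) ((div_lt_one hlam).2 (by linarith))
  have hsq : Tendsto (fun n => (N ^ n) i j / lam ^ n) atTop (𝓝 0) := by
    refine squeeze_zero (fun n => div_nonneg (hNn0 _ _ _) (by positivity)) (fun n => ?_)
      (by simpa using hρ.mul_const (r i / r j))
    have h1 := hle n i j
    rw [div_pow, div_mul_div_comm, div_le_div_iff₀ (by positivity)
      (mul_pos (by positivity) (hr j))]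
    have h3 : (N ^ n) i j * r j ≤ (lam - δ) ^ n * r i := by
      refine le_of_mul_le_mul_right ?_ (hl j)
      linarith
    nlinarith [pow_pos hlam n]
  have := hsq.add (((tendsto_const_nhds (x := (1 : ℝ))).sub hρ).mul_const (r i * l j))
  simp only [sub_zero, one_mul, zero_add] at this
  refine this.congr fun n => ?_
  rw [hMn n, div_pow]
  have : lam ^ n ≠ 0 := by positivity
  simp only [hP, Matrix.add_apply, Matrix.smul_apply, vecMulVec_apply, smul_eq_mul]
  field_simp

open Matrix in
/-- A nonnegative sequence with `a n = M a (n + 1)` consists of multiples of the right Perron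
eigenvector. -/
theorem eq_smul_of_eq_mulVec_succ (hM : ∀ i j, 0 < M i j) (hr : ∀ v, 0 < r v)
    (hl : ∀ v, 0 < l v) (hMr : M *ᵥ r = lam • r) (hlM : l ᵥ* M = lam • l)
    (hlr : ∑ v, l v * r v = 1) {a : ℕ → V → ℝ} (ha : ∀ n v, 0 ≤ a n v)
    (hrec : ∀ n, a n = M *ᵥ a (n + 1)) (n : ℕ) (v : V) :
    a n v * lam ^ n = (∑ w, l w * a 0 w) * r v := by
  have hlam : 0 < lam := by
    have h1 := congrFun hMr v
    have h2 : 0 < (M *ᵥ r) v :=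
      Finset.sum_pos (fun j _ => mul_pos (hM v j) (hr j)) Finset.univ_nonempty
    rw [h1] at h2
    exact pos_of_mul_pos_left h2 (hr v).le
  have hpow : ∀ n k, a n = (M ^ k) *ᵥ a (n + k) := by
    intro n k
    induction k with
    | zero => simp
    | succ k ih => rw [ih, hrec (n + k), mulVec_mulVec, ← pow_succ, add_assoc]
  have hdot : ∀ n, ∑ w, l w * a n w = lam * ∑ w, l w * a (n + 1) w := by
    intro n
    have : l ⬝ᵥ a n = lam * (l ⬝ᵥ a (n + 1)) := by
      rw [hrec n, dotProduct_mulVec, hlM, smul_dotProduct, smul_eq_mul]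
    exact this
  have hdotk : ∀ n k, ∑ w, l w * a n w = lam ^ k * ∑ w, l w * a (n + k) w := by
    intro n k
    induction k with
    | zero => simp
    | succ k ih => rw [ih, hdot (n + k), pow_succ, mul_assoc, add_assoc]
  suffices h : a n v = (∑ w, l w * a n w) * r v by
    rw [hdotk 0 n, zero_add, h]
    ring
  set c := ∑ w, l w * a n w with hc
  -- The pairing of `lam ^ k • a (n + k)` with `l` does not depend on `k`, so positivity keeps these
  -- vectors bounded.
  have hb : ∀ k w, |lam ^ k * a (n + k) w| ≤ c / l w := fun k w => by
    rw [abs_of_nonneg (mul_nonneg (by positivity) (ha _ _)), le_div_iff₀ (hl w), hc, hdotk n k]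
    have h2 := Finset.single_le_sum (f := fun w => l w * a (n + k) w)
      (fun w _ => mul_nonneg (hl w).le (ha _ _)) (Finset.mem_univ w)
    nlinarith [pow_pos hlam k]
  -- Boundedness allows `M ^ k / lam ^ k` to be replaced by its limit `r lᵀ` in `a n = M ^ k a (n +
  -- k)`.
  have hlim : Tendsto (fun k => ∑ w, ((M ^ k) v w / lam ^ k - r v * l w) *
      (lam ^ k * a (n + k) w)) atTop (𝓝 0) := by
    rw [← Finset.sum_const_zero (s := (Finset.univ : Finset V))]
    refine tendsto_finsetSum _ fun w _ => ?_
    have h1 : Tendsto (fun k => (M ^ k) v w / lam ^ k - r v * l w) atTop (𝓝 0) := by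
      simpa using (tendsto_pow_div_pow hM hr hl hMr hlM hlr v w).sub_const (r v * l w)
    exact h1.zero_mul_isBoundedUnder_le ⟨c / l w, eventually_map.2 (Eventually.of_forall
      fun k => by simpa using hb k w)⟩
  have hconst : ∀ k, ∑ w, ((M ^ k) v w / lam ^ k - r v * l w) * (lam ^ k * a (n + k) w) =
      a n v - c * r v := fun k => by
    have h1 : ∀ w, ((M ^ k) v w / lam ^ k - r v * l w) * (lam ^ k * a (n + k) w) =
        (M ^ k) v w * a (n + k) w - r v * (lam ^ k * (l w * a (n + k) w)) := fun w => by
      have : lam ^ k ≠ 0 := by positivity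
      field_simp
    rw [Finset.sum_congr rfl fun w _ => h1 w, Finset.sum_sub_distrib, ← Finset.mul_sum,
      ← Finset.mul_sum, ← hdotk n k, mul_comm c]
    congr 1
    exact (congrFun (hpow n k) v).symm
  simp only [hconst] at hlim
  have := tendsto_nhds_unique hlim tendsto_const_nhds
  linarith

end Perron

namespace StationaryDiagram

/-! ### The incidence matrix: growth of the heights and `lam > 1`. -/

section Incidence

variable {V E : Type*} [Fintype V] [Nonempty V] [Fintype E] [PartialOrder E]
  {B : StationaryDiagram V E}

omit [Fintype V] [Nonempty V] in
open Classical in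
theorem incidence_apply (i j : V) : B.incidence i j =
    ((Finset.univ.filter fun e : E => B.src e = i ∧ B.tgt e = j).card : ℝ) := by
  rw [incidence, Matrix.of_apply, Nat.card_eq_fintype_card, Fintype.card_subtype]

omit [Fintype V] [Nonempty V] in
theorem incidence_pos (H1 : ∀ i j : V, ∃ e : E, B.src e = i ∧ B.tgt e = j) (i j : V) :
    0 < B.incidence i j := by
  classical
  rw [incidence_apply, Nat.cast_pos, Finset.card_pos]
  obtain ⟨e, he⟩ := H1 i j
  exact ⟨e, by simp [he]⟩

omit [Nonempty V] in
open Classical in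
theorem sum_filter_tgt (f : V → ℝ) (v : V) :
    ∑ e : E with B.tgt e = v, f (B.src e) = ∑ i, f i * B.incidence i v := by
  rw [← Finset.sum_fiberwise _ B.src]
  refine Finset.sum_congr rfl fun i _ => ?_
  rw [Finset.sum_congr rfl (g := fun _ => f i)
    (fun e he => by rw [(Finset.mem_filter.1 he).2]), Finset.sum_const, nsmul_eq_mul, mul_comm,
    incidence_apply, Finset.filter_filter]
  simp only [and_comm]

omit [Nonempty V] in
open Classical in
theorem sum_filter_src (f : V → ℝ) (v : V) :
    ∑ e : E with B.src e = v, f (B.tgt e) = ∑ j, B.incidence v j * f j := by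
  rw [← Finset.sum_fiberwise _ B.tgt]
  refine Finset.sum_congr rfl fun i _ => ?_
  rw [Finset.sum_congr rfl (g := fun _ => f i)
    (fun e he => by rw [(Finset.mem_filter.1 he).2]), Finset.sum_const, nsmul_eq_mul,
    incidence_apply, Finset.filter_filter]

variable {lam : ℝ} {r l : V → ℝ}

omit [Nonempty V] in
open Classical in
theorem height_eq (n : ℕ) (v : V) :
    (B.height n v : ℝ) = ∑ i, (B.incidence ^ n) i v := by
  induction n generalizing v with
  | zero => simp [height, Matrix.one_apply]
  | succ n ih =>
    rw [height, Nat.cast_sum]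
    refine (sum_filter_tgt (fun i => (B.height n i : ℝ)) v).trans ?_
    simp only [ih, pow_succ, Matrix.mul_apply, Finset.sum_mul]
    exact Finset.sum_comm

theorem IsPerron.tendsto_height (h : B.IsPerron lam r l)
    (H1 : ∀ i j : V, ∃ e : E, B.src e = i ∧ B.tgt e = j) (v : V) :
    Tendsto (fun n => (B.height n v : ℝ) / lam ^ n) atTop (𝓝 (l v)) := by
  classical
  have := tendsto_finsetSum Finset.univ fun i _ => tendsto_pow_div_pow (incidence_pos H1)
    h.right_pos h.left_pos h.right_eigen h.left_eigen h.sum_left_right i v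
  rw [← Finset.sum_mul, h.sum_right, one_mul] at this
  refine this.congr fun n => ?_
  rw [height_eq, Finset.sum_div]

/-- Summing the eigenvector equation gives `lam = ∑ e, r (tgt e)`. Every vertex is a target, so this
is at least `∑ r = 1`, and strictly more unless `tgt` is injective. An injective `tgt` with (H1)
leaves one vertex and one edge, hence a single path, which perfectness forbids. -/
theorem IsPerron.one_lt (h : B.IsPerron lam r l)
    (H1 : ∀ i j : V, ∃ e : E, B.src e = i ∧ B.tgt e = j) [PerfectSpace B.PathSpace] :
    1 < lam := by
  classical
  have hsum : ∀ v, lam * r v = ∑ e : E with B.src e = v, r (B.tgt e) := fun v => by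
    rw [sum_filter_src]
    exact (congrFun h.right_eigen v).symm
  have hlam : lam = ∑ e : E, r (B.tgt e) := by
    rw [← Finset.sum_fiberwise _ B.src, ← Finset.sum_congr rfl fun v _ => hsum v,
      ← Finset.mul_sum, h.sum_right, mul_one]
  by_contra! hle
  have hinj : Function.Injective B.tgt := by
    intro e f hef
    by_contra hne
    choose g hg using B.exists_tgt
    obtain ⟨e', he'⟩ : ∃ e', ∀ v, g v ≠ e' := by
      by_contra! hall
      obtain ⟨v, rfl⟩ := hall e
      obtain ⟨w, rfl⟩ := hall f
      rw [hg, hg] at hef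
      exact hne (congrArg g hef)
    have hginj : Function.Injective g := fun v w hvw => by rw [← hg v, hvw, hg]
    have h1 : ∑ e ∈ Finset.univ.image g, r (B.tgt e) = 1 := by
      rw [Finset.sum_image hginj.injOn, ← h.sum_right]
      simp only [hg]
    have h2 := Finset.sum_lt_sum_of_subset (f := fun e => r (B.tgt e))
      (Finset.subset_univ (Finset.univ.image g)) (Finset.mem_univ e') (by simpa using he')
      (h.right_pos _) fun e _ _ => (h.right_pos _).le
    rw [h1, ← hlam] at h2
    exact absurd h2 (not_lt.2 hle)
  have hsub : Subsingleton B.PathSpace := by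
    have hV : Subsingleton V := ⟨fun i j => by
      obtain ⟨e, he, het⟩ := H1 i i
      obtain ⟨f, hf, hft⟩ := H1 j i
      rw [← he, ← hf, hinj (het.trans hft.symm)]⟩
    have hE : Subsingleton E := ⟨fun e f => hinj (Subsingleton.elim _ _)⟩
    exact ⟨fun x y => Subtype.ext (Subsingleton.elim _ _)⟩
  have x : B.PathSpace := Classical.arbitrary _
  have := PerfectSpace.univ_preperfect (α := B.PathSpace) x (Set.mem_univ x)
  rw [accPt_iff_nhds] at this
  obtain ⟨y, -, hy⟩ := this Set.univ univ_mem
  exact hy (Subsingleton.elim _ _)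

end Incidence

end StationaryDiagram

namespace StationaryDiagram

/-! ### Invariant measures -/

/-! ### Cylinders as a π-system generating the Borel sets. -/

section Topology

variable {V E : Type*} [PartialOrder E] {B : StationaryDiagram V E}

theorem isOpen_coord (j : ℕ) (s : Set E) : IsOpen {x : B.PathSpace | x.1 j ∈ s} := by
  let : TopologicalSpace E := ⊥
  have : DiscreteTopology E := ⟨rfl⟩
  have : Continuous fun x : B.PathSpace => x.1 j :=
    (continuous_apply j).comp continuous_induced_dom
  exact (isOpen_discrete s).preimage this

theorem measurableSet_coord (j : ℕ) (s : Set E) : MeasurableSet {x : B.PathSpace | x.1 j ∈ s} :=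
  (isOpen_coord j s).measurableSet

theorem isOpen_cylinder (x : B.PathSpace) (n : ℕ) : IsOpen (B.cylinder x n) := by
  have : B.cylinder x n = {y : B.PathSpace | y.1 0 ∈ {e | B.src e = B.src (x.1 0)}} ∩
      ⋂ i ∈ Finset.range n, {y : B.PathSpace | y.1 i ∈ ({x.1 i} : Set E)} := by
    ext y
    simp [cylinder]
  rw [this]
  exact (isOpen_coord _ _).inter (isOpen_biInter_finset fun i _ => isOpen_coord _ _)

theorem measurableSet_base (i : V) : MeasurableSet (B.base i) :=
  measurableSet_coord 0 {e | B.src e = i}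

theorem measurable_tail (n : ℕ) : Measurable (B.tail n) := by
  refine Continuous.measurable ?_
  let : TopologicalSpace E := ⊥
  refine continuous_induced_rng.2 (continuous_pi fun j => ?_)
  exact (continuous_apply (n + j)).comp continuous_induced_dom

theorem isTopologicalBasis_cylinder :
    TopologicalSpace.IsTopologicalBasis
      {s : Set B.PathSpace | ∃ x n, s = B.cylinder x n} := by
  refine TopologicalSpace.isTopologicalBasis_of_isOpen_of_nhds ?_ fun x u hx hu => ?_
  · rintro _ ⟨x, n, rfl⟩
    exact isOpen_cylinder x n
  · let : TopologicalSpace E := ⊥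
    have : DiscreteTopology E := ⟨rfl⟩
    obtain ⟨t, ht, rfl⟩ := isOpen_induced_iff.1 hu
    obtain ⟨I, v, hv, hvt⟩ := isOpen_pi_iff.1 ht x.1 hx
    obtain ⟨n, hn⟩ := I.exists_nat_subset_range
    refine ⟨_, ⟨x, n, rfl⟩, ⟨rfl, fun _ _ => rfl⟩, fun y hy => hvt fun i hi => ?_⟩
    have h1 : y.1 i = x.1 i := hy.2 i (Finset.mem_range.1 (hn hi))
    exact Set.mem_of_eq_of_mem h1 (hv i hi).2

theorem cylinder_eq_of_mem {x y : B.PathSpace} {n : ℕ} (h : y ∈ B.cylinder x n) :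
    B.cylinder y n = B.cylinder x n := by
  ext z
  exact ⟨fun hz => ⟨hz.1.trans h.1, fun i hi => (hz.2 i hi).trans (h.2 i hi)⟩,
    fun hz => ⟨hz.1.trans h.1.symm, fun i hi => (hz.2 i hi).trans (h.2 i hi).symm⟩⟩

theorem countable_cylinders [Finite E] :
    {s : Set B.PathSpace | ∃ x n, s = B.cylinder x n}.Countable := by
  have : {s : Set B.PathSpace | ∃ x n, s = B.cylinder x n} =
      ⋃ n, Set.range fun x => B.cylinder x n := by
    ext s
    simp only [Set.mem_ofPred_eq, Set.mem_iUnion, Set.mem_range]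
    exact ⟨fun ⟨x, n, h⟩ => ⟨n, x, h.symm⟩, fun ⟨n, x, h⟩ => ⟨x, n, h.symm⟩⟩
  rw [this]
  refine Set.countable_iUnion fun n => Set.Finite.countable ?_
  have hfin : (Set.range fun x : B.PathSpace => fun j : Fin (n + 1) => x.1 j).Finite :=
    Set.toFinite _
  refine (hfin.image fun w => {y : B.PathSpace | B.src (y.1 0) = B.src (w 0) ∧
    ∀ i : Fin (n + 1), i.1 < n → y.1 i = w i}).subset ?_
  rintro _ ⟨x, rfl⟩
  refine ⟨_, ⟨x, rfl⟩, ?_⟩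
  ext y
  refine and_congr Iff.rfl ⟨fun h i hi => h ⟨i, by omega⟩ hi, fun h i hi => h i hi⟩

theorem borel_eq_generateFrom_cylinder [Finite E] :
    borel B.PathSpace =
      MeasurableSpace.generateFrom {s : Set B.PathSpace | ∃ x n, s = B.cylinder x n} := by
  have : SecondCountableTopology B.PathSpace :=
    isTopologicalBasis_cylinder.secondCountableTopology countable_cylinders
  exact isTopologicalBasis_cylinder.borel_eq_generateFrom

/-- Two cylinders that meet can be recentred at a common point and are then nested. -/
theorem isPiSystem_cylinder :
    IsPiSystem {s : Set B.PathSpace | ∃ x n, s = B.cylinder x n} := by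
  rintro _ ⟨x, m, rfl⟩ _ ⟨y, n, rfl⟩ ⟨z, hzx, hzy⟩
  rw [← cylinder_eq_of_mem hzx, ← cylinder_eq_of_mem hzy]
  refine ⟨z, max m n, ?_⟩
  ext w
  refine ⟨fun h => ⟨h.1.1, fun i hi => ?_⟩, fun h => ⟨⟨h.1, fun i hi => h.2 i
    (lt_max_of_lt_left hi)⟩, ⟨h.1, fun i hi => h.2 i (lt_max_of_lt_right hi)⟩⟩⟩
  rcases lt_max_iff.1 hi with hi | hi
  exacts [h.1.2 i hi, h.2.2 i hi]

theorem exists_glue (x z : B.PathSpace) (n : ℕ) (h : B.src (x.1 n) = B.src (z.1 0)) :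
    ∃ w ∈ B.cylinder x n, B.tail n w = z := by
  refine ⟨⟨fun j => if j < n then x.1 j else z.1 (j - n), fun j => ?_⟩, ⟨?_, fun i hi => ?_⟩, ?_⟩
  · rcases lt_trichotomy (j + 1) n with hj | hj | hj
    · simp only [hj, (Nat.lt_succ_self j).trans hj, if_true]
      exact x.2 j
    · subst hj
      simp only [Nat.lt_succ_self, lt_irrefl, if_true, if_false, Nat.sub_self]
      exact (x.2 j).trans h
    · have h1 : ¬ j < n := by omega
      have h2 : ¬ j + 1 < n := by omega
      have h3 : j + 1 - n = j - n + 1 := by omega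
      simp only [h1, h2, h3, if_false]
      exact z.2 _
  · rcases Nat.eq_zero_or_pos n with rfl | hn
    · simpa using h.symm
    · simp [hn]
  · simp [hi]
  · exact Subtype.ext (funext fun j => by simp [tail])

theorem cylinder_inter_tail (w : B.PathSpace) (n m : ℕ) :
    B.cylinder w n ∩ B.tail n ⁻¹' B.cylinder (B.tail n w) m = B.cylinder w (n + m) := by
  ext y
  refine ⟨fun h => ⟨h.1.1, fun i hi => ?_⟩, fun h => ⟨cylinder_anti h (Nat.le_add_right n m),
    src_eq_of_mem_cylinder (n := n) (cylinder_anti h (Nat.le_add_right n m)),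
    fun i hi => h.2 _ (by omega)⟩⟩
  rcases lt_or_ge i n with hin | hin
  · exact h.1.2 i hin
  · have := h.2.2 (i - n) (by omega)
    simpa [Nat.add_sub_cancel' hin] using this

end Topology

/-! ### The invariant measure of the floors and the law of the tail. -/

section Invariant

variable {V E : Type*} [Fintype E] [PartialOrder E] {B : StationaryDiagram V E}

theorem measurable_pos (n : ℕ) : Measurable (B.pos n) := by
  induction n with
  | zero => exact measurable_const
  | succ n ih =>
    let : MeasurableSpace E := ⊤
    have hc : Measurable fun x : B.PathSpace => x.1 n := fun s _ => measurableSet_coord n s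
    exact ih.add ((measurable_from_top (f := B.below n)).comp hc)

theorem measurableSet_tail_pos (n p : ℕ) (v : V) :
    MeasurableSet {y | B.tail n y ∈ B.base v ∧ B.pos n y = p} :=
  ((measurable_tail n) (measurableSet_base v)).inter (measurable_pos n (measurableSet_singleton p))

/-- Only floor `0` is entered from the top of a tower, so the preimage of floor `p + 1` is floor
`p`, and invariance makes all floors over `v` equally heavy. -/
theorem measure_tail_pos (hB : B.ProperlyOrdered) {μ : Measure B.PathSpace}
    (hμ : MeasurePreserving B.vershik μ μ) (n : ℕ) {p : ℕ} {v : V} (hp : p < B.height n v) :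
    μ {y | B.tail n y ∈ B.base v ∧ B.pos n y = p} = μ (B.minCylinder n v) := by
  induction p with
  | zero => rw [minCylinder_eq]
  | succ p ih =>
    rw [← ih (by omega),
      ← hμ.measure_preimage (measurableSet_tail_pos n (p + 1) v).nullMeasurableSet]
    have hT := isTower hB n
    congr 1
    ext y
    have h0 := hT.pos_lt y
    constructor
    · rintro ⟨h1, h2⟩
      rcases Nat.lt_or_eq_of_le (Nat.succ_le_of_lt h0) with hs | hs
      · obtain ⟨h3, h4⟩ := hT.step y hs
        exact ⟨h3 ▸ h1, by omega⟩
      · have := (hT.top y hs).2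
        omega
    · rintro ⟨h1, h2⟩
      have h3 : B.src ((B.tail n y).1 0) = v := h1
      obtain ⟨h4, h5⟩ := hT.step y (by rw [h3]; omega)
      exact ⟨h4 ▸ h1, by omega⟩

theorem measure_cylinder_eq_minCylinder (hB : B.ProperlyOrdered) {μ : Measure B.PathSpace}
    (hμ : MeasurePreserving B.vershik μ μ) (x : B.PathSpace) (n : ℕ) :
    μ (B.cylinder x n) = μ (B.minCylinder n (B.src (x.1 n))) := by
  rw [cylinder_eq hB, measure_tail_pos hB hμ n (pos_lt hB n x)]

open Classical in
-- The next edge `e` cuts a bottom floor into floors of rank `below n e` in the towers of the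
-- following level.
theorem measure_minCylinder_eq_sum (hB : B.ProperlyOrdered) {μ : Measure B.PathSpace}
    (hμ : MeasurePreserving B.vershik μ μ) (n : ℕ) (v : V) :
    μ (B.minCylinder n v) = ∑ e : E with B.src e = v, μ (B.minCylinder (n + 1) (B.tgt e)) := by
  have hset : B.minCylinder n v = ⋃ e ∈ Finset.univ.filter (fun e : E => B.src e = v),
      {y | B.tail (n + 1) y ∈ B.base (B.tgt e) ∧ B.pos (n + 1) y = B.below n e} := by
    ext y
    simp only [minCylinder_eq, Set.mem_iUnion, Finset.mem_filter, Finset.mem_univ, true_and,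
      exists_prop]
    constructor
    · rintro ⟨h1, h2⟩
      exact ⟨y.1 n, h1, (y.2 n).symm, by rw [pos, h2, zero_add]⟩
    · rintro ⟨e, rfl, h1, h2⟩
      have he : y.1 n = e := eq_of_below_eq (B := B) (n := n) (p := B.pos n y) (q := 0)
        ((y.2 n).trans h1) (pos_lt hB n y) (height_pos _ _) (by rw [zero_add]; exact h2)
      rw [pos, he] at h2
      exact ⟨congrArg B.src he, by omega⟩
  rw [hset, measure_biUnion_finset]
  · refine Finset.sum_congr rfl fun e _ => measure_tail_pos hB hμ (n + 1) ?_
    have := below_add_le_height (B := B) n e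
    have := height_pos (B := B) n (B.src e)
    omega
  · intro e _ f _ hef
    refine Set.disjoint_left.2 fun y h1 h2 => hef ?_
    exact eq_of_below_eq (B := B) (n := n) (p := 0) (q := 0)
      (h1.1.symm.trans h2.1) (height_pos _ _) (height_pos _ _)
      (by rw [zero_add, zero_add, ← h1.2, ← h2.2])
  · exact fun e _ => measurableSet_tail_pos _ _ _

variable [Fintype V] [Nonempty V] {lam : ℝ} {r l : V → ℝ} {μ : Measure B.PathSpace}
  [IsProbabilityMeasure μ]

open Classical in
-- The floor measures satisfy `a n = M a (n + 1)`, which forces them to be multiples of `r`; the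
-- constant is `1` because the floors of level one partition the space.
theorem IsPerron.measureReal_minCylinder (h : B.IsPerron lam r l) (hB : B.ProperlyOrdered)
    (H1 : ∀ i j : V, ∃ e : E, B.src e = i ∧ B.tgt e = j)
    (hμ : MeasurePreserving B.vershik μ μ) (n : ℕ) (v : V) :
    μ.real (B.minCylinder n v) * lam ^ n = r v := by
  set a : ℕ → V → ℝ := fun n v => μ.real (B.minCylinder n v) with ha
  have hrec : ∀ n, a n = Matrix.mulVec B.incidence (a (n + 1)) := fun n => funext fun v => by
    refine Eq.trans ?_ (sum_filter_src (B := B) (a (n + 1)) v)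
    simp only [ha, Measure.real, measure_minCylinder_eq_sum hB hμ n v]
    exact ENNReal.toReal_sum fun _ _ => measure_ne_top _ _
  have hmain := eq_smul_of_eq_mulVec_succ (incidence_pos H1) h.right_pos h.left_pos h.right_eigen
    h.left_eigen h.sum_left_right (a := a) (fun _ _ => measureReal_nonneg) hrec
  have hone : ∑ v, a 0 v = 1 := by
    have h1 : (⋃ v ∈ (Finset.univ : Finset V), B.minCylinder 0 v) = Set.univ := by
      ext y
      simp [minCylinder]
    have h2 := measureReal_biUnion_finset (μ := μ) (s := (Finset.univ : Finset V))
      (f := B.minCylinder 0) (fun v _ w _ hvw => Set.disjoint_left.2 fun y hy hy' =>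
        hvw (hy.1.symm.trans hy'.1)) fun v _ => by
          rw [minCylinder_eq]; exact measurableSet_tail_pos _ _ _
    rw [h1, probReal_univ] at h2
    exact h2.symm
  have hc : ∑ w, l w * a 0 w = 1 := by
    have h1 : ∑ v, a 0 v = (∑ w, l w * a 0 w) * ∑ v, r v := by
      rw [Finset.mul_sum]
      exact Finset.sum_congr rfl fun v _ => by simpa using hmain 0 v
    rw [hone, h.sum_right, mul_one] at h1
    exact h1.symm
  rw [← one_mul (r v), ← hc]
  exact hmain n v

theorem IsPerron.measure_cylinder (h : B.IsPerron lam r l) (hlam : 0 < lam)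
    (hB : B.ProperlyOrdered) (H1 : ∀ i j : V, ∃ e : E, B.src e = i ∧ B.tgt e = j)
    (hμ : MeasurePreserving B.vershik μ μ) (x : B.PathSpace) (n : ℕ) :
    μ (B.cylinder x n) = ENNReal.ofReal (r (B.src (x.1 n)) / lam ^ n) := by
  rw [measure_cylinder_eq_minCylinder hB hμ, ← ofReal_measureReal]
  congr 1
  rw [eq_div_iff (by positivity)]
  exact h.measureReal_minCylinder hB H1 hμ n _

/-- The conditional law of the tail given a cylinder. -/
theorem IsPerron.map_tail_restrict (h : B.IsPerron lam r l) (hlam : 0 < lam)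
    (hB : B.ProperlyOrdered) (H1 : ∀ i j : V, ∃ e : E, B.src e = i ∧ B.tgt e = j)
    (hμ : MeasurePreserving B.vershik μ μ) {x : B.PathSpace} {n : ℕ} {i : V}
    (hx : B.src (x.1 n) = i) :
    (μ.restrict (B.cylinder x n)).map (B.tail n) =
      ENNReal.ofReal ((lam ^ n)⁻¹) • μ.restrict (B.base i) := by
  have hmain : ∀ z ∈ B.base i, ∀ m, (μ.restrict (B.cylinder x n)).map (B.tail n) (B.cylinder z m) =
      (ENNReal.ofReal ((lam ^ n)⁻¹) • μ.restrict (B.base i)) (B.cylinder z m) := by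
    intro z hz m
    -- After gluing, the preimage within the cylinder is itself a cylinder, of length `n + m` and
    -- with the terminal vertex of the tail cylinder, so its measure carries the extra factor `(lam
    -- ^ n)⁻¹`.
    obtain ⟨w, hw, rfl⟩ := exists_glue x z n (hx.trans hz.symm)
    have hsub : B.cylinder (B.tail n w) m ⊆ B.base i := fun y hy => hy.1.trans hz
    rw [Measure.map_apply (measurable_tail n) (isOpen_cylinder _ _).measurableSet,
      Measure.restrict_apply ((measurable_tail n) (isOpen_cylinder _ _).measurableSet),
      ← cylinder_eq_of_mem hw, Set.inter_comm, cylinder_inter_tail, Measure.smul_apply,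
      Measure.restrict_apply (isOpen_cylinder _ _).measurableSet, Set.inter_eq_left.2 hsub,
      h.measure_cylinder hlam hB H1 hμ, h.measure_cylinder hlam hB H1 hμ, smul_eq_mul,
      ← ENNReal.ofReal_mul (by positivity), tail_apply, pow_add]
    congr 1
    field_simp
  obtain ⟨z, hz⟩ := B.exists_path_from i
  have hz0 : B.cylinder z 0 = B.base i := by
    ext y
    exact ⟨fun hy => hy.1.trans hz, fun hy => ⟨hy.trans hz.symm, fun _ hi => absurd hi (by omega)⟩⟩
  refine ext_of_generate_finite _ borel_eq_generateFrom_cylinder isPiSystem_cylinder ?_ ?_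
  · rintro _ ⟨y, m, rfl⟩
    by_cases hy : y ∈ B.base i
    · exact hmain y hy m
    · have h1 : ∀ w ∈ B.cylinder y m, w ∉ B.base i := fun w hw hwi => hy (hw.1.symm.trans hwi)
      rw [Measure.map_apply (measurable_tail n) (isOpen_cylinder _ _).measurableSet,
        Measure.restrict_apply ((measurable_tail n) (isOpen_cylinder _ _).measurableSet),
        Measure.smul_apply, Measure.restrict_apply (isOpen_cylinder _ _).measurableSet]
      have h2 : B.tail n ⁻¹' B.cylinder y m ∩ B.cylinder x n = ∅ :=
        Set.eq_empty_of_forall_notMem fun w hw =>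
          h1 _ hw.1 ((src_eq_of_mem_cylinder hw.2).trans hx)
      have h3 : B.cylinder y m ∩ B.base i = ∅ :=
        Set.eq_empty_of_forall_notMem fun w hw => h1 w hw.1 hw.2
      simp [h2, h3]
  · have h1 := hmain z hz 0
    rw [hz0] at h1
    rw [Measure.map_apply (measurable_tail n) MeasurableSet.univ]
    rw [Measure.map_apply (measurable_tail n) (measurableSet_base i), Measure.restrict_apply
      ((measurable_tail n) (measurableSet_base i)), Set.inter_eq_right.2
      (show B.cylinder x n ⊆ B.tail n ⁻¹' B.base i from
        fun w hw => (src_eq_of_mem_cylinder hw).trans hx)] at h1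
    simpa using h1

end Invariant

end StationaryDiagram

/-! ### The law of the sequence of gaps between entrance times -/

section Kac

open scoped ENNReal

variable {X : Type*} [MeasurableSpace X] {T : X → X} {I : Set X}

open Classical in
theorem Recurrent.measurable_entranceTime (h : Recurrent T I) (hT : Measurable T)
    (hI : MeasurableSet I) (k : ℕ) : Measurable (entranceTime T I k) := by
  induction k with
  | zero => exact measurable_const
  | succ k ih =>
    have heq : entranceTime T I (k + 1) = fun x => Nat.find (h.exists_gt x (entranceTime T I k x)) :=
      funext fun x =>
      h.entranceTime_succ_eq (Nat.find_spec (h.exists_gt x _)).1 (Nat.find_spec (h.exists_gt x _)).2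
        fun j hj hjI => Nat.find_min' _ ⟨hj, hjI⟩
    rw [heq]
    refine measurable_find _ fun m => ?_
    exact (measurableSet_lt ih measurable_const).inter (hT.iterate m hI)

theorem Measurable.iterate_apply (hT : Measurable T) {N : X → ℕ} (hN : Measurable N) :
    Measurable fun x => T^[N x] x := by
  have : Measurable fun p : ℕ × X => T^[p.1] p.2 :=
    measurable_from_prod_countable_right fun m => hT.iterate m
  exact this.comp (hN.prodMk measurable_id)

theorem measurable_sum_range {f : ℕ → X → ℝ≥0∞} (hf : ∀ u, Measurable (f u)) {N : X → ℕ}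
    (hN : Measurable N) : Measurable fun x => ∑ u ∈ Finset.range (N x), f u x := by
  have h : Measurable fun p : ℕ × X => ∑ u ∈ Finset.range p.1, f u p.2 :=
    measurable_from_prod_countable_right fun m =>
      Finset.measurable_fun_sum (Finset.range m) fun u _ => hf u
  exact h.comp (hN.prodMk measurable_id)

/-- Kac's formula weighted by the point of the next visit. Let `c u` be the contribution of the
points of `I` with return time exactly `u`. From `u` to `u + 1` the right side drops by `c u` by
definition, the left side by invariance: if `T x` has waiting time `u`, then `x` has waiting time `u
+ 1` or `T x ∈ I`. Both sides tend to zero. -/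
theorem Recurrent.lintegral_entranceTime_eq (h : Recurrent T I) {μ : Measure X}
    [IsFiniteMeasure μ] (hμ : MeasurePreserving T μ μ) (hI : MeasurableSet I) {φ : X → ℝ≥0∞}
    (hφ : Measurable φ) {C : ℝ≥0∞} (hC : C ≠ ∞) (hφC : ∀ x, φ x ≤ C) {u : ℕ} (hu : 0 < u) :
    ∫⁻ x, {x | entranceTime T I 1 x = u}.indicator
        (fun x => φ (T^[entranceTime T I 1 x] x)) x ∂μ =
      ∫⁻ x in I, {x | u ≤ entranceTime T I 1 x}.indicator
        (fun x => φ (T^[entranceTime T I 1 x] x)) x ∂μ := by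
  set N : X → ℕ := entranceTime T I 1 with hNdef
  have hN : Measurable N := h.measurable_entranceTime hμ.measurable hI 1
  set ψ : X → ℝ≥0∞ := fun x => φ (T^[N x] x) with hψdef
  have hψ : Measurable ψ := hφ.comp (hμ.measurable.iterate_apply hN)
  have hF : ∀ u, Measurable ({x | N x = u}.indicator ψ) := fun u =>
    hψ.indicator (hN (measurableSet_singleton u))
  have hG : ∀ u, Measurable ({x | u ≤ N x}.indicator ψ) := fun u =>
    hψ.indicator (measurableSet_le measurable_const hN)
  set a : ℕ → ℝ≥0∞ := fun u => ∫⁻ x, {x | N x = u}.indicator ψ x ∂μ with ha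
  set b : ℕ → ℝ≥0∞ := fun u => ∫⁻ x in I, {x | u ≤ N x}.indicator ψ x ∂μ with hb
  set c : ℕ → ℝ≥0∞ := fun u => ∫⁻ x in I, {x | N x = u}.indicator ψ x ∂μ with hc
  have hac : ∀ u, 0 < u → a u = a (u + 1) + c u := by
    intro u hu
    have hpt : ∀ x, {x | N x = u}.indicator ψ (T x) = {x | N x = u + 1}.indicator ψ x +
        I.indicator ({x | N x = u}.indicator ψ) (T x) := by
      intro x
      by_cases hTx : T x ∈ I
      · have h1 : N x = 1 := h.entranceTime_succ_eq Nat.one_pos hTx fun j hj _ => hj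
        -- The waiting time `1` differs from `u + 1` because `0 < u`.
        have h2 : x ∉ {x | N x = u + 1} := fun h3 => by
          have h3 : N x = u + 1 := h3
          omega
        rw [Set.indicator_of_notMem h2, zero_add, Set.indicator_of_mem hTx]
      · have h1 : N x = N (T x) + 1 := by
          refine h.entranceTime_succ_eq (Nat.succ_pos _) ?_ fun j hj hjI => ?_
          · rw [Function.iterate_succ_apply]
            exact h.iterate_entranceTime_mem 0 (T x)
          · obtain ⟨j, rfl⟩ := Nat.exists_eq_succ_of_ne_zero (Nat.pos_iff_ne_zero.1 hj)
            rw [Function.iterate_succ_apply] at hjI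
            refine Nat.succ_le_succ (entranceTime_succ_le ?_ hjI)
            rcases Nat.eq_zero_or_pos j with rfl | hj0
            · exact absurd hjI hTx
            · exact hj0
        have h2 : ψ (T x) = ψ x := by
          simp only [hψdef, h1, Function.iterate_succ_apply]
        rw [Set.indicator_of_notMem hTx, add_zero]
        simp only [Set.indicator_apply, Set.mem_ofPred_eq, h1, Nat.add_right_cancel_iff, h2]
    calc a u = ∫⁻ x, {x | N x = u}.indicator ψ (T x) ∂μ := (hμ.lintegral_comp (hF u)).symm
      _ = a (u + 1) + ∫⁻ x, I.indicator ({x | N x = u}.indicator ψ) (T x) ∂μ := by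
          simp only [hpt]
          exact lintegral_add_left (hF (u + 1)) _
      _ = a (u + 1) + c u := by
          rw [hμ.lintegral_comp ((hF u).indicator hI), lintegral_indicator hI]
  have hbc : ∀ u, b u = b (u + 1) + c u := by
    intro u
    have hpt : ∀ x, {x | u ≤ N x}.indicator ψ x = {x | u + 1 ≤ N x}.indicator ψ x +
        {x | N x = u}.indicator ψ x := by
      intro x
      simp only [Set.indicator_apply, Set.mem_ofPred_eq]
      rcases lt_trichotomy (N x) u with h1 | h1 | h1
      · simp [h1.not_ge, h1.ne, (Nat.lt_succ_of_lt h1).not_ge]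
      · simp [h1]
      · simp [h1.le, h1.ne', Nat.succ_le_of_lt h1]
    simp only [hb, hc, hpt]
    exact lintegral_add_left (hG (u + 1)) _
  -- Equality of the decrements of `a` and `b`, written without subtraction; cancelling `c` needs it
  -- finite, hence the bound on `φ`.
  have hkey : ∀ k, a u + b (u + k) = b u + a (u + k) := by
    intro k
    induction k with
    | zero => exact add_comm _ _
    | succ k ih =>
      have h1 := hac (u + k) (by omega)
      have h2 := hbc (u + k)
      have hfin : c (u + k) ≠ ∞ := by
        refine ne_top_of_le_ne_top (ENNReal.mul_ne_top hC (measure_ne_top μ Set.univ)) ?_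
        rw [← lintegral_const]
        refine (setLIntegral_le_lintegral _ _).trans (lintegral_mono fun x => ?_)
        exact (Set.indicator_le_self _ _ _).trans (hφC _)
      rw [h1, h2, ← add_assoc, ← add_assoc] at ih
      exact (ENNReal.add_left_inj hfin).1 ih
  have hlim : ∀ (μ' : Measure X) [IsFiniteMeasure μ'] (A : ℕ → Set X),
      (∀ u, MeasurableSet (A u)) → (∀ x, ∀ᶠ u in atTop, x ∉ A u) →
      Tendsto (fun u => ∫⁻ x, (A u).indicator ψ x ∂μ') atTop (𝓝 0) := by
    intro μ' _ A hA hev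
    have := tendsto_lintegral_of_dominated_convergence (μ := μ')
      (F := fun u => (A u).indicator ψ) (f := fun _ => 0) (fun _ => C)
      (fun u => hψ.indicator (hA u))
      (fun u => Eventually.of_forall fun x => (Set.indicator_le_self _ _ _).trans (hφC _))
      (by rw [lintegral_const]; exact ENNReal.mul_ne_top hC (measure_ne_top _ _))
      (Eventually.of_forall fun x => tendsto_const_nhds.congr' ((hev x).mono fun u hu =>
        (Set.indicator_of_notMem hu ψ).symm))
    simpa using this
  have hlima : Tendsto (fun k => a (u + k)) atTop (𝓝 0) := by
    refine (hlim μ (fun u => {x | N x = u}) (fun u => hN (measurableSet_singleton u))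
      fun x => ?_).comp (tendsto_atTop_mono (Nat.le_add_left · u) tendsto_id)
    filter_upwards [eventually_gt_atTop (N x)] with u hu
    exact hu.ne
  have hlimb : Tendsto (fun k => b (u + k)) atTop (𝓝 0) := by
    refine (hlim (μ.restrict I) (fun u => {x | u ≤ N x})
      (fun u => measurableSet_le measurable_const hN)
      fun x => ?_).comp (tendsto_atTop_mono (Nat.le_add_left · u) tendsto_id)
    filter_upwards [eventually_gt_atTop (N x)] with u hu
    exact hu.not_ge
  have h1 := hlimb.const_add (a u)
  have h2 := hlima.const_add (b u)
  simp only [hkey, add_zero] at h1 h2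
  exact tendsto_nhds_unique h1 h2

/-- The sequence `(a, s 0, s 1, …)`. -/
def natCons {α : Type*} (a : α) (s : ℕ → α) : ℕ → α := fun k => Nat.casesOn k a s

/-- The sequence of gaps between consecutive entrance times, rescaled by `ρ`. -/
noncomputable def gapSeq (T : X → X) (I : Set X) (ρ : ℝ≥0) (x : X) (k : ℕ) : ℝ≥0 :=
  ((entranceTime T I (k + 1) x - entranceTime T I k x : ℕ) : ℝ≥0) * ρ

theorem Recurrent.measurable_gapSeq (h : Recurrent T I) (hT : Measurable T)
    (hI : MeasurableSet I) (ρ : ℝ≥0) : Measurable (gapSeq T I ρ) := by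
  refine measurable_pi_iff.2 fun k => ?_
  have h1 := (h.measurable_entranceTime hT hI (k + 1)).sub (h.measurable_entranceTime hT hI k)
  exact ((measurable_from_top (f := fun m : ℕ => (m : ℝ≥0))).comp h1).mul_const ρ

omit [MeasurableSpace X] in
theorem Recurrent.gapSeq_eq (h : Recurrent T I) (ρ : ℝ≥0) (x : X) :
    gapSeq T I ρ x = natCons ((entranceTime T I 1 x : ℝ≥0) * ρ)
      (gapSeq T I ρ (T^[entranceTime T I 1 x] x)) := by
  funext k
  cases k with
  | zero => simp [gapSeq, natCons, entranceTime]
  | succ k =>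
    simp only [gapSeq, natCons]
    rw [h.entranceTime_succ' (k + 1) x, h.entranceTime_succ' k x, Nat.add_sub_add_left]

theorem measurable_natCons {α β : Type*} [MeasurableSpace α] [MeasurableSpace β] {f : β → α}
    {g : β → ℕ → α} (hf : Measurable f) (hg : Measurable g) :
    Measurable fun x => natCons (f x) (g x) := by
  refine measurable_pi_iff.2 fun k => ?_
  cases k with
  | zero => exact hf
  | succ k => exact (measurable_pi_apply k).comp hg

/-- A point of `I` with return time `N` stands for the waiting times `1, …, N`, and all gaps after
the first entrance are gaps after its return. -/
theorem Recurrent.lintegral_gapSeq (h : Recurrent T I) {μ : Measure X}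
    [IsFiniteMeasure μ] (hμ : MeasurePreserving T μ μ) (hI : MeasurableSet I) (ρ : ℝ≥0)
    {Φ : (ℕ → ℝ≥0) → ℝ≥0∞} (hΦ : Measurable Φ) {C : ℝ≥0∞} (hC : C ≠ ∞) (hΦC : ∀ s, Φ s ≤ C) :
    ∫⁻ x, Φ (gapSeq T I ρ x) ∂μ =
      ∫⁻ x in I, ∑ u ∈ Finset.range (entranceTime T I 1 x),
        Φ (natCons (((u + 1 : ℕ) : ℝ≥0) * ρ) (gapSeq T I ρ (T^[entranceTime T I 1 x] x))) ∂μ := by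
  set N : X → ℕ := entranceTime T I 1 with hNdef
  have hN : Measurable N := h.measurable_entranceTime hμ.measurable hI 1
  set φ : ℕ → X → ℝ≥0∞ := fun u y => Φ (natCons (((u + 1 : ℕ) : ℝ≥0) * ρ) (gapSeq T I ρ y))
  have hφ : ∀ u, Measurable (φ u) := fun u =>
    hΦ.comp (measurable_natCons measurable_const (h.measurable_gapSeq hμ.measurable hI ρ))
  have hψ : ∀ u, Measurable fun x => φ u (T^[N x] x) := fun u =>
    (hφ u).comp (hμ.measurable.iterate_apply hN)
  have hleft : ∀ x, Φ (gapSeq T I ρ x) =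
      ∑' u : ℕ, {x | N x = u + 1}.indicator (fun x => φ u (T^[N x] x)) x := by
    intro x
    obtain ⟨u, hu⟩ := Nat.exists_eq_succ_of_ne_zero (h.entranceTime_lt 0 x).ne'
    have hu : N x = u + 1 := hu
    rw [tsum_eq_single u fun v hv => Set.indicator_of_notMem (fun hv' => hv (by
      have hv' : N x = v + 1 := hv'
      omega)) _, Set.indicator_of_mem (show x ∈ {x | N x = u + 1} from hu), h.gapSeq_eq]
    simp only [φ, ← hNdef, hu]
  have hright : ∀ x, ∑ u ∈ Finset.range (N x), φ u (T^[N x] x) =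
      ∑' u : ℕ, {x | u + 1 ≤ N x}.indicator (fun x => φ u (T^[N x] x)) x := by
    intro x
    have h0 : ∀ u ∉ Finset.range (N x),
        {x | u + 1 ≤ N x}.indicator (fun x => φ u (T^[N x] x)) x = 0 := fun u hu =>
      Set.indicator_of_notMem (show x ∉ {x | u + 1 ≤ N x} from
        fun hu' => hu (Finset.mem_range.2 hu')) _
    rw [tsum_eq_sum h0]
    exact Finset.sum_congr rfl fun u hu => (Set.indicator_of_mem
      (show x ∈ {x | u + 1 ≤ N x} from Finset.mem_range.1 hu) (fun x => φ u (T^[N x] x))).symm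
  have h1 : ∀ u, Measurable ({x | N x = u + 1}.indicator (fun x => φ u (T^[N x] x))) := fun u =>
    (hψ u).indicator (hN (measurableSet_singleton (u + 1)))
  have h2 : ∀ u, Measurable ({x | u + 1 ≤ N x}.indicator (fun x => φ u (T^[N x] x))) := fun u =>
    (hψ u).indicator (measurableSet_le measurable_const hN)
  refine (lintegral_congr hleft).trans (Eq.trans ?_ (lintegral_congr fun x => (hright x).symm))
  rw [lintegral_tsum fun u => (h1 u).aemeasurable, lintegral_tsum fun u => (h2 u).aemeasurable]
  exact tsum_congr fun u =>
    h.lintegral_entranceTime_eq hμ hI (hφ u) hC (fun _ => hΦC _) (Nat.succ_pos u)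

/-- Spreads each waiting time over an interval of length `θ`, so that all levels can be compared on
one space. -/
theorem sum_range_eq_lintegral_ceil (f : ℕ → ℝ≥0∞) {θ : ℝ} (hθ : 0 < θ) (g : ℕ) :
    ENNReal.ofReal θ * ∑ u ∈ Finset.range g, f (u + 1) =
      ∫⁻ s in Set.Ioc 0 (g * θ), f ⌈s / θ⌉₊ := by
  induction g with
  | zero => simp
  | succ g ih =>
    have h1 : Set.Ioc 0 (((g + 1 : ℕ) : ℝ) * θ) =
        Set.Ioc 0 (g * θ) ∪ Set.Ioc (g * θ) (((g + 1 : ℕ) : ℝ) * θ) := by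
      rw [Set.Ioc_union_Ioc_eq_Ioc (by positivity)]
      push_cast
      nlinarith
    have h2 : ∫⁻ s in Set.Ioc (g * θ) (((g + 1 : ℕ) : ℝ) * θ), f ⌈s / θ⌉₊ =
        ENNReal.ofReal θ * f (g + 1) := by
      rw [setLIntegral_congr_fun measurableSet_Ioc (g := fun _ => f (g + 1)), setLIntegral_const,
        Real.volume_Ioc, mul_comm]
      · congr 2
        push_cast
        ring
      · intro s hs
        have : ⌈s / θ⌉₊ = g + 1 := by
          rw [Nat.ceil_eq_iff (Nat.succ_ne_zero g)]
          exact ⟨(lt_div_iff₀ hθ).2 (by simpa using hs.1), (div_le_iff₀ hθ).2 hs.2⟩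
        simp only [this]
    rw [Finset.sum_range_succ, mul_add, ih, h1, lintegral_union measurableSet_Ioc, h2]
    exact Set.Ioc_disjoint_Ioc_of_le le_rfl

end Kac

/-! ### Gap sequences with divergent sum. -/

/-- The sequences of gaps whose partial sums tend to infinity. -/
def divergentSeq : Set (ℕ → ℝ≥0) := {s | ∑' k, (s k : ENNReal) = ⊤}

theorem measurableSet_divergentSeq : MeasurableSet divergentSeq := by
  have : Measurable fun s : ℕ → ℝ≥0 => ∑' k, (s k : ENNReal) :=
    Measurable.tsum fun k => (measurable_pi_apply k).coe_nnreal_ennreal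
  exact this (measurableSet_singleton ⊤)

/-- The first gap is left free: in the limit it can be arbitrarily small, and only genuine return
times have a positive lower bound. -/
theorem mem_divergentSeq {s : ℕ → ℝ≥0} {ε : ℝ≥0} (hε : 0 < ε) (h : ∀ k, ε ≤ s (k + 1)) :
    s ∈ divergentSeq := by
  have h1 : ∑' k, (s (k + 1) : ENNReal) = ⊤ := by
    rw [eq_top_iff, ← ENNReal.tsum_const_eq_top_of_ne_zero (α := ℕ) (ENNReal.coe_ne_zero.2 hε.ne')]
    exact ENNReal.tsum_le_tsum fun k => ENNReal.coe_le_coe.2 (h k)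
  show ∑' k, (s k : ENNReal) = ⊤
  rw [tsum_eq_zero_add' ENNReal.summable, h1, add_top]

theorem tendsto_natCons {α β : Type*} [TopologicalSpace α] {F : Filter β} {f : β → α}
    {g : β → ℕ → α} {a : α} {s : ℕ → α} (hf : Tendsto f F (𝓝 a)) (hg : Tendsto g F (𝓝 s)) :
    Tendsto (fun x => natCons (f x) (g x)) F (𝓝 (natCons a s)) := by
  refine tendsto_pi_nhds.2 fun k => ?_
  cases k with
  | zero => exact hf
  | succ k => exact tendsto_pi_nhds.1 hg k

namespace StationaryDiagram

/-! ### The gaps on a fixed parameter space, and their limit. -/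

section Limit

open scoped ENNReal

variable {V E : Type*} [Fintype V] [Nonempty V] [Fintype E] [PartialOrder E]
  {B : StationaryDiagram V E}

omit [Fintype V] in
-- The return is itself a passage through `i`; this yields the lower bounds on all later gaps.
theorem passageCount_pairAt_pos (hB : B.ProperlyOrdered)
    (H1 : ∀ i j : V, ∃ e : E, B.src e = i ∧ B.tgt e = j) {one : V}
    (H3 : ∀ e : E, IsMin e → B.src e = one) (i : V) (k : ℕ) (z : B.PathSpace) :
    1 ≤ B.passageCount i (B.pairAt i k z).1 (B.pairAt i k z).2 i := by
  have hrec := recurrent_base hB H1 i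
  rw [pairAt, passageCount_eq hB H1 H3]
  set y := B.vershik^[entranceTime B.vershik (B.base i) k z] z
  refine (Set.ncard_pos ?_).2 ?_
  · exact (Set.finite_Iic (entranceTime B.vershik (B.base i) 1 y)).subset fun j hj => hj.2.1
  · exact ⟨_, hrec.entranceTime_lt 0 y, le_rfl, hrec.iterate_entranceTime_mem 0 y⟩

theorem returnHeight_pairAt_pos (hB : B.ProperlyOrdered)
    (H1 : ∀ i j : V, ∃ e : E, B.src e = i ∧ B.tgt e = j) {one : V}
    (H3 : ∀ e : E, IsMin e → B.src e = one) (i : V) (n k : ℕ) (z : B.PathSpace) :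
    1 ≤ B.returnHeight i n (B.pairAt i k z) := by
  have h1 := passageCount_pairAt_pos hB H1 H3 i k z
  have h2 := height_pos (B := B) n i
  refine (Nat.mul_pos h1 h2).trans_le ?_
  exact Finset.single_le_sum (f := fun v => B.passageCount i (B.pairAt i k z).1 (B.pairAt i k z).2 v *
    B.height n v) (fun _ _ => Nat.zero_le _) (Finset.mem_univ i)

theorem le_cbar_pairAt (hB : B.ProperlyOrdered)
    (H1 : ∀ i j : V, ∃ e : E, B.src e = i ∧ B.tgt e = j) {one : V}
    (H3 : ∀ e : E, IsMin e → B.src e = one) {l : V → ℝ} (hl : ∀ v, 0 < l v) (i : V) (k : ℕ)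
    (z : B.PathSpace) : l i ≤ B.cbar l i (B.pairAt i k z) := by
  have h1 : (1 : ℝ) ≤ B.passageCount i (B.pairAt i k z).1 (B.pairAt i k z).2 i := by
    exact_mod_cast passageCount_pairAt_pos hB H1 H3 i k z
  refine (le_mul_of_one_le_left (hl i).le h1).trans ?_
  exact Finset.single_le_sum (f := fun v => (B.passageCount i (B.pairAt i k z).1
    (B.pairAt i k z).2 v : ℝ) * l v) (fun v _ => mul_nonneg (Nat.cast_nonneg _) (hl v).le)
    (Finset.mem_univ i)

theorem IsPerron.tendsto_returnHeight {lam : ℝ} {r l : V → ℝ} (h : B.IsPerron lam r l)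
    (H1 : ∀ i j : V, ∃ e : E, B.src e = i ∧ B.tgt e = j) (i : V) (ef : E × E) :
    Tendsto (fun n => (B.returnHeight i n ef : ℝ) * (lam ^ n)⁻¹) atTop (𝓝 (B.cbar l i ef)) := by
  have := tendsto_finsetSum Finset.univ fun v _ =>
    (h.tendsto_height H1 v).const_mul (B.passageCount i ef.1 ef.2 v : ℝ)
  refine this.congr fun n => ?_
  rw [returnHeight, Nat.cast_sum, Finset.sum_mul]
  refine Finset.sum_congr rfl fun v _ => ?_
  push_cast
  ring

omit [Fintype V] [Nonempty V] in
theorem measurable_comp_pairAt (hB : B.ProperlyOrdered)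
    (H1 : ∀ i j : V, ∃ e : E, B.src e = i ∧ B.tgt e = j) (hV : Measurable B.vershik) (i : V)
    (k : ℕ) {α : Type*} [MeasurableSpace α] (f : E × E → α) :
    Measurable fun z => f (B.pairAt i k z) := by
  let _ : MeasurableSpace (E × E) := ⊤
  have h1 : Measurable fun y : B.PathSpace => (y.1 0, y.1 1) := by
    refine measurable_to_countable' fun ef => ?_
    have : (fun y : B.PathSpace => (y.1 0, y.1 1)) ⁻¹' {ef} =
        {y | y.1 0 ∈ ({ef.1} : Set E)} ∩ {y | y.1 1 ∈ ({ef.2} : Set E)} := by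
      ext y
      exact Prod.ext_iff
    rw [this]
    exact (measurableSet_coord _ _).inter (measurableSet_coord _ _)
  exact (measurable_from_top (f := f)).comp (h1.comp (hV.iterate_apply
    ((recurrent_base hB H1 i).measurable_entranceTime hV (measurableSet_base i) k)))

variable (B) in
/-- The parameter space of the points of the first return tower over the vertex `i`. -/
noncomputable def towerMeasure (μ : Measure B.PathSpace) (i : V) : Measure (B.PathSpace × ℝ) :=
  (μ.restrict (B.base i)).prod (volume.restrict (Set.Ioi 0))

variable (B) in
/-- The part of `B.PathSpace × ℝ` that describes the cylinder of level `n + 1`. -/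
def towerSet (lam : ℝ) (i : V) (n : ℕ) : Set (B.PathSpace × ℝ) :=
  {p | p.2 ≤ B.returnHeight i n (B.pairAt i 0 p.1) * (lam ^ n)⁻¹}

variable (B) in
/-- The gaps of the point with parameter `p`, for the cylinder of level `n + 1`. -/
noncomputable def towerGaps (lam : ℝ) (r : V → ℝ) (i : V) (n : ℕ) (p : B.PathSpace × ℝ) : ℕ → ℝ≥0 :=
  natCons ((⌈p.2 / (lam ^ n)⁻¹⌉₊ : ℝ≥0) * (r i / lam ^ n).toNNReal)
    fun k => (B.returnHeight i n (B.pairAt i (k + 1) p.1) : ℝ≥0) * (r i / lam ^ n).toNNReal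

variable (B) in
/-- The limit of `towerSet`. -/
def limitSet (l : V → ℝ) (i : V) : Set (B.PathSpace × ℝ) :=
  {p | p.2 ≤ B.cbar l i (B.pairAt i 0 p.1)}

variable (B) in
/-- The limit of `towerGaps`. -/
noncomputable def limitGaps (r l : V → ℝ) (i : V) (p : B.PathSpace × ℝ) : ℕ → ℝ≥0 :=
  natCons (r i * p.2).toNNReal fun k => (r i * B.cbar l i (B.pairAt i (k + 1) p.1)).toNNReal

theorem measurableSet_towerSet (hB : B.ProperlyOrdered)
    (H1 : ∀ i j : V, ∃ e : E, B.src e = i ∧ B.tgt e = j) (hV : Measurable B.vershik) (lam : ℝ)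
    (i : V) (n : ℕ) : MeasurableSet (B.towerSet lam i n) :=
  measurableSet_le measurable_snd ((measurable_comp_pairAt hB H1 hV i 0
    (fun ef => (B.returnHeight i n ef : ℝ) * (lam ^ n)⁻¹)).comp measurable_fst)

theorem measurableSet_limitSet (hB : B.ProperlyOrdered)
    (H1 : ∀ i j : V, ∃ e : E, B.src e = i ∧ B.tgt e = j) (hV : Measurable B.vershik) (l : V → ℝ)
    (i : V) : MeasurableSet (B.limitSet l i) :=
  measurableSet_le measurable_snd
    ((measurable_comp_pairAt hB H1 hV i 0 (B.cbar l i)).comp measurable_fst)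

theorem measurable_towerGaps (hB : B.ProperlyOrdered)
    (H1 : ∀ i j : V, ∃ e : E, B.src e = i ∧ B.tgt e = j) (hV : Measurable B.vershik) (lam : ℝ)
    (r : V → ℝ) (i : V) (n : ℕ) : Measurable (B.towerGaps lam r i n) := by
  refine measurable_natCons ?_ (measurable_pi_iff.2 fun k => ?_)
  · refine Measurable.mul_const ?_ _
    exact (measurable_from_top (f := fun m : ℕ => (m : ℝ≥0))).comp
      (Nat.measurable_ceil.comp (measurable_snd.div_const _))
  · exact (measurable_comp_pairAt hB H1 hV i (k + 1) (fun ef =>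
      (B.returnHeight i n ef : ℝ≥0) * (r i / lam ^ n).toNNReal)).comp measurable_fst

theorem measurable_limitGaps (hB : B.ProperlyOrdered)
    (H1 : ∀ i j : V, ∃ e : E, B.src e = i ∧ B.tgt e = j) (hV : Measurable B.vershik)
    (r l : V → ℝ) (i : V) : Measurable (B.limitGaps r l i) := by
  refine measurable_natCons ?_ (measurable_pi_iff.2 fun k => ?_)
  · exact (measurable_snd.const_mul _).real_toNNReal
  · exact (measurable_comp_pairAt hB H1 hV i (k + 1) (fun ef =>
      (r i * B.cbar l i ef).toNNReal)).comp measurable_fst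

variable {lam : ℝ} {r l : V → ℝ} {μ : Measure B.PathSpace} [IsProbabilityMeasure μ]

/-- The law of the gaps, in terms of the tower over the vertex `i`. -/
theorem IsPerron.lintegral_gapSeq (h : B.IsPerron lam r l) (hlam : 0 < lam)
    (hB : B.ProperlyOrdered) (H1 : ∀ i j : V, ∃ e : E, B.src e = i ∧ B.tgt e = j) {one : V}
    (H3 : ∀ e : E, IsMin e → B.src e = one) (hμ : MeasurePreserving B.vershik μ μ)
    {x : B.PathSpace} {n : ℕ} {i : V} (hx : B.src (x.1 n) = i) {Φ : (ℕ → ℝ≥0) → ℝ≥0∞}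
    (hΦ : Measurable Φ) {C : ℝ≥0∞} (hC : C ≠ ∞) (hΦC : ∀ s, Φ s ≤ C) :
    ∫⁻ y, Φ (gapSeq B.vershik (B.cylinder x n) (r i / lam ^ n).toNNReal y) ∂μ =
      ∫⁻ p in B.towerSet lam i n, Φ (B.towerGaps lam r i n p) ∂(B.towerMeasure μ i) := by
  have hrec := recurrent_cylinder hB H1 x n
  have hI : MeasurableSet (B.cylinder x n) := (isOpen_cylinder x n).measurableSet
  have hV := hμ.measurable
  set ρ := (r i / lam ^ n).toNNReal with hρ
  -- The mesh is the factor from the law of the tail, so that factor and the sum over waiting times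
  -- combine into a plain Lebesgue integral.
  have hθ : 0 < (lam ^ n)⁻¹ := by positivity
  set s : B.PathSpace → ℕ → ℝ≥0 := fun z k => (B.returnHeight i n (B.pairAt i (k + 1) z) : ℝ≥0) * ρ
    with hs
  have hsm : Measurable s := measurable_pi_iff.2 fun k => measurable_comp_pairAt hB H1 hV i (k + 1)
    (fun ef => (B.returnHeight i n ef : ℝ≥0) * ρ)
  set K : B.PathSpace → ℝ≥0∞ := fun z => ∑ u ∈ Finset.range (B.returnHeight i n (B.pairAt i 0 z)),
    Φ (natCons (((u + 1 : ℕ) : ℝ≥0) * ρ) (s z)) with hK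
  have hKm : Measurable K := measurable_sum_range
    (fun u => hΦ.comp (measurable_natCons measurable_const hsm))
    (measurable_comp_pairAt hB H1 hV i 0 (B.returnHeight i n))
  have hind : Measurable ((B.towerSet lam i n).indicator fun p => Φ (B.towerGaps lam r i n p)) :=
    (hΦ.comp (measurable_towerGaps hB H1 hV lam r i n)).indicator
      (measurableSet_towerSet hB H1 hV lam i n)
  rw [hrec.lintegral_gapSeq hμ hI ρ hΦ hC hΦC]
  have h1 : ∀ y ∈ B.cylinder x n, ∑ u ∈ Finset.range (entranceTime B.vershik (B.cylinder x n) 1 y),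
      Φ (natCons (((u + 1 : ℕ) : ℝ≥0) * ρ) (gapSeq B.vershik (B.cylinder x n) ρ
        (B.vershik^[entranceTime B.vershik (B.cylinder x n) 1 y] y))) = K (B.tail n y) := by
    intro y hy
    have h2 : entranceTime B.vershik (B.cylinder x n) 1 y =
        B.returnHeight i n (B.pairAt i 0 (B.tail n y)) := by
      rw [entranceTime_cylinder_succ hB H1 H3 hx hy 0]
      exact zero_add _
    have h3 : gapSeq B.vershik (B.cylinder x n) ρ
        (B.vershik^[entranceTime B.vershik (B.cylinder x n) 1 y] y) = s (B.tail n y) := by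
      funext k
      have h4 := congrFun (hrec.gapSeq_eq ρ y) (k + 1)
      refine Eq.trans h4.symm ?_
      rw [gapSeq, entranceTime_cylinder_succ hB H1 H3 hx hy (k + 1), Nat.add_sub_cancel_left]
    rw [h3, h2]
  rw [setLIntegral_congr_fun hI h1, ← lintegral_map hKm (measurable_tail n),
    h.map_tail_restrict hlam hB H1 hμ hx, lintegral_smul_measure, smul_eq_mul,
    ← lintegral_const_mul _ hKm, ← lintegral_indicator (measurableSet_towerSet hB H1 hV lam i n),
    towerMeasure, lintegral_prod _ hind.aemeasurable]
  refine lintegral_congr fun z => ?_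
  rw [hK, sum_range_eq_lintegral_ceil (fun m => Φ (natCons ((m : ℝ≥0) * ρ) (s z))) hθ]
  have h5 : (fun t : ℝ => (B.towerSet lam i n).indicator
      (fun p => Φ (B.towerGaps lam r i n p)) (z, t)) =
      (Set.Iic ((B.returnHeight i n (B.pairAt i 0 z) : ℝ) * (lam ^ n)⁻¹)).indicator
        (fun t => Φ (natCons ((⌈t / (lam ^ n)⁻¹⌉₊ : ℝ≥0) * ρ) (s z))) := rfl
  rw [h5, setLIntegral_indicator measurableSet_Iic, Set.inter_comm, Set.Ioi_inter_Iic]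

omit [IsProbabilityMeasure μ] in
-- On the graph of the limiting roof the indicators of the regions need not converge; its vertical
-- sections are points, so it is null.
theorem ae_towerMeasure (hB : B.ProperlyOrdered)
    (H1 : ∀ i j : V, ∃ e : E, B.src e = i ∧ B.tgt e = j) (hV : Measurable B.vershik) (l : V → ℝ)
    (i : V) : ∀ᵐ p ∂(B.towerMeasure μ i), 0 < p.2 ∧ p.2 ≠ B.cbar l i (B.pairAt i 0 p.1) := by
  have hm : Measurable fun p : B.PathSpace × ℝ => B.cbar l i (B.pairAt i 0 p.1) :=
    (measurable_comp_pairAt hB H1 hV i 0 (B.cbar l i)).comp measurable_fst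
  have hset : MeasurableSet {p : B.PathSpace × ℝ |
      0 < p.2 ∧ p.2 ≠ B.cbar l i (B.pairAt i 0 p.1)} :=
    (measurableSet_lt measurable_const measurable_snd).inter
      (measurableSet_eq_fun measurable_snd hm).compl
  rw [towerMeasure, Measure.ae_prod_iff_ae_ae hset]
  refine Eventually.of_forall fun z => ?_
  refine (ae_restrict_mem measurableSet_Ioi).and (ae_restrict_of_ae ?_)
  have h1 : ∀ᵐ t ∂(volume : Measure ℝ), t ≠ B.cbar l i (B.pairAt i 0 z) :=
    compl_mem_ae_iff.2 (measure_singleton _)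
  exact h1

theorem IsPerron.towerGaps_mem (h : B.IsPerron lam r l) (hlam : 0 < lam) (hB : B.ProperlyOrdered)
    (H1 : ∀ i j : V, ∃ e : E, B.src e = i ∧ B.tgt e = j) {one : V}
    (H3 : ∀ e : E, IsMin e → B.src e = one) (i : V) (n : ℕ) (p : B.PathSpace × ℝ) :
    B.towerGaps lam r i n p ∈ divergentSeq := by
  refine mem_divergentSeq (ε := (r i / lam ^ n).toNNReal)
    (Real.toNNReal_pos.2 (div_pos (h.right_pos i) (by positivity))) fun k => ?_
  refine le_mul_of_one_le_left zero_le ?_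
  exact_mod_cast returnHeight_pairAt_pos hB H1 H3 i n (k + 1) p.1

theorem IsPerron.limitGaps_mem (h : B.IsPerron lam r l) (hB : B.ProperlyOrdered)
    (H1 : ∀ i j : V, ∃ e : E, B.src e = i ∧ B.tgt e = j) {one : V}
    (H3 : ∀ e : E, IsMin e → B.src e = one) (i : V) (p : B.PathSpace × ℝ) :
    B.limitGaps r l i p ∈ divergentSeq :=
  mem_divergentSeq (ε := (r i * l i).toNNReal)
    (Real.toNNReal_pos.2 (mul_pos (h.right_pos i) (h.left_pos i))) fun k =>
      Real.toNNReal_le_toNNReal (mul_le_mul_of_nonneg_left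
        (le_cbar_pairAt hB H1 H3 h.left_pos i (k + 1) p.1) (h.right_pos i).le)

/-- As `lam > 1` the mesh tends to zero and the rounding up in the first gap disappears. -/
theorem IsPerron.tendsto_towerGaps (h : B.IsPerron lam r l) (hlam : 1 < lam)
    (H1 : ∀ i j : V, ∃ e : E, B.src e = i ∧ B.tgt e = j) (i : V) {p : B.PathSpace × ℝ}
    (hp : 0 < p.2) :
    Tendsto (fun n => B.towerGaps lam r i n p) atTop (𝓝 (B.limitGaps r l i p)) := by
  have hpow := tendsto_pow_atTop_atTop_of_one_lt hlam
  have hcoe : ∀ (m n : ℕ), (m : ℝ≥0) * (r i / lam ^ n).toNNReal =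
      (r i * ((m : ℝ) * (lam ^ n)⁻¹)).toNNReal := fun m n => by
    rw [show r i * ((m : ℝ) * (lam ^ n)⁻¹) = m * (r i / lam ^ n) by ring,
      Real.toNNReal_mul (Nat.cast_nonneg m), Real.toNNReal_natCast]
  refine tendsto_natCons ?_ (tendsto_pi_nhds.2 fun k => ?_)
  · simp only [hcoe]
    refine (continuous_real_toNNReal.tendsto _).comp (Tendsto.const_mul (r i) ?_)
    refine ((tendsto_nat_ceil_mul_div_atTop hp.le).comp hpow).congr fun n => ?_
    simp only [Function.comp_apply, div_inv_eq_mul]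
    rw [div_eq_mul_inv]
  · simp only [hcoe]
    exact (continuous_real_toNNReal.tendsto _).comp
      (Tendsto.const_mul (r i) (h.tendsto_returnHeight H1 i _))

/-- The gap sequences converge in law, tested against functions continuous on `divergentSeq`. -/
theorem IsPerron.tendsto_lintegral_towerGaps (h : B.IsPerron lam r l) (hlam : 1 < lam)
    (hB : B.ProperlyOrdered) (H1 : ∀ i j : V, ∃ e : E, B.src e = i ∧ B.tgt e = j) {one : V}
    (H3 : ∀ e : E, IsMin e → B.src e = one) (hV : Measurable B.vershik) (i : V)
    {Φ : (ℕ → ℝ≥0) → ℝ≥0∞} (hΦ : Measurable Φ) (hΦc : ContinuousOn Φ divergentSeq) {C : ℝ≥0∞}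
    (hC : C ≠ ∞) (hΦC : ∀ s, Φ s ≤ C) :
    Tendsto (fun n => ∫⁻ p in B.towerSet lam i n, Φ (B.towerGaps lam r i n p)
        ∂(B.towerMeasure μ i)) atTop
      (𝓝 (∫⁻ p in B.limitSet l i, Φ (B.limitGaps r l i p) ∂(B.towerMeasure μ i))) := by
  have hlam0 : 0 < lam := one_pos.trans hlam
  -- Only finitely many pairs of edges exist, so all roofs lie below one `K`; this gives the
  -- integrable majorant.
  have hbd : ∃ K : ℝ, ∀ (ef : E × E) (n : ℕ), (B.returnHeight i n ef : ℝ) * (lam ^ n)⁻¹ ≤ K := by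
    have h1 : ∀ ef : E × E, ∃ K : ℝ, ∀ n : ℕ,
        (B.returnHeight i n ef : ℝ) * (lam ^ n)⁻¹ ≤ K := fun ef => by
      obtain ⟨K, hK⟩ := (h.tendsto_returnHeight H1 i ef).bddAbove_range
      exact ⟨K, fun n => hK ⟨n, rfl⟩⟩
    choose K hK using h1
    obtain ⟨M, hM⟩ := (Set.finite_range K).bddAbove
    exact ⟨M, fun ef n => (hK ef n).trans (hM ⟨ef, rfl⟩)⟩
  obtain ⟨K, hK⟩ := hbd
  have hKset : MeasurableSet {p : B.PathSpace × ℝ | p.2 ≤ K} :=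
    measurableSet_le measurable_snd measurable_const
  simp only [← lintegral_indicator (measurableSet_towerSet hB H1 hV lam i _),
    ← lintegral_indicator (measurableSet_limitSet hB H1 hV l i)]
  refine tendsto_lintegral_of_dominated_convergence
    ({p : B.PathSpace × ℝ | p.2 ≤ K}.indicator fun _ => C) (fun n => ?_) (fun n => ?_) ?_ ?_
  · exact (hΦ.comp (measurable_towerGaps hB H1 hV lam r i n)).indicator
      (measurableSet_towerSet hB H1 hV lam i n)
  · refine Eventually.of_forall fun p => ?_
    by_cases hp : p ∈ B.towerSet lam i n
    · rw [Set.indicator_of_mem hp,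
        Set.indicator_of_mem (show p ∈ {p : B.PathSpace × ℝ | p.2 ≤ K} from hp.trans (hK _ n))]
      exact hΦC _
    · rw [Set.indicator_of_notMem hp]
      exact zero_le
  · rw [lintegral_indicator_const hKset]
    refine ENNReal.mul_ne_top hC ?_
    have h1 : {p : B.PathSpace × ℝ | p.2 ≤ K} = Set.univ ×ˢ Set.Iic K := by
      ext p
      simp
    rw [h1, towerMeasure, Measure.prod_prod, Measure.restrict_apply measurableSet_Iic,
      Set.inter_comm, Set.Ioi_inter_Iic, Real.volume_Ioc]
    exact ENNReal.mul_ne_top (measure_ne_top _ _) ENNReal.ofReal_ne_top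
  · filter_upwards [ae_towerMeasure (μ := μ) hB H1 hV l i] with p hp
    have hlim := h.tendsto_returnHeight H1 i (B.pairAt i 0 p.1)
    -- Off the limiting roof, a point is eventually inside or eventually outside the regions.
    rcases lt_or_gt_of_ne hp.2 with hlt | hlt
    · rw [Set.indicator_of_mem (show p ∈ B.limitSet l i from hlt.le)]
      have h1 : Tendsto (fun n => Φ (B.towerGaps lam r i n p)) atTop
          (𝓝 (Φ (B.limitGaps r l i p))) := by
        refine (hΦc _ (h.limitGaps_mem hB H1 H3 i p)).tendsto.comp
          (tendsto_nhdsWithin_iff.2 ⟨h.tendsto_towerGaps hlam H1 i hp.1,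
            Eventually.of_forall fun n => h.towerGaps_mem hlam0 hB H1 H3 i n p⟩)
      refine h1.congr' ((hlim.eventually_const_lt hlt).mono fun n hn => ?_)
      exact (Set.indicator_of_mem (show p ∈ B.towerSet lam i n from hn.le)
        fun p => Φ (B.towerGaps lam r i n p)).symm
    · rw [Set.indicator_of_notMem (show p ∉ B.limitSet l i from hlt.not_ge)]
      refine tendsto_const_nhds.congr' ((hlim.eventually_lt_const hlt).mono fun n hn => ?_)
      exact (Set.indicator_of_notMem (show p ∉ B.towerSet lam i n from hn.not_ge)
        fun p => Φ (B.towerGaps lam r i n p)).symm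

end Limit

end StationaryDiagram

/-! ### The point process of a divergent sequence of gaps -/

section PointProcess

theorem exists_lt_sum_of_mem_divergentSeq {s : ℕ → ℝ≥0} (hs : s ∈ divergentSeq) (K : ℝ≥0) :
    ∃ m, K < ∑ j ∈ Finset.range m, s j := by
  have h1 : Tendsto (fun m => ∑ j ∈ Finset.range m, (s j : ENNReal)) atTop (𝓝 ⊤) := by
    have := ENNReal.tendsto_nat_tsum (fun j => (s j : ENNReal))
    rwa [show ∑' j, (s j : ENNReal) = ⊤ from hs] at this
  obtain ⟨m, hm⟩ := (h1.eventually_const_lt (ENNReal.coe_lt_top (r := K))).exists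
  exact ⟨m, by exact_mod_cast hm⟩

theorem lt_sum_of_le {s : ℕ → ℝ≥0} {K : ℝ≥0} {m k : ℕ} (h : K < ∑ j ∈ Finset.range m, s j)
    (hk : m ≤ k) : K < ∑ j ∈ Finset.range (k + 1), s j :=
  h.trans_le (Finset.sum_le_sum_of_subset (Finset.range_mono (by omega)))

theorem isLocallyFiniteMeasure_arrivalMeasure {s : ℕ → ℝ≥0} (hs : s ∈ divergentSeq) :
    IsLocallyFiniteMeasure (arrivalMeasure s) := by
  refine ⟨fun x => ⟨Set.Iio (x + 1), Iio_mem_nhds (lt_add_one x), ?_⟩⟩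
  obtain ⟨m, hm⟩ := exists_lt_sum_of_mem_divergentSeq hs (x + 1)
  rw [arrivalMeasure, Measure.sum_apply _ measurableSet_Iio,
    tsum_eq_sum (s := Finset.range m) fun k hk => ?_]
  · exact ENNReal.sum_lt_top.2 fun k _ => measure_lt_top _ _
  · rw [Measure.dirac_apply' _ measurableSet_Iio, Set.indicator_of_notMem]
    exact (lt_sum_of_le hm (by simpa using hk)).le.not_gt

theorem integral_arrivalMeasure {s : ℕ → ℝ≥0} (hs : s ∈ divergentSeq) (f : C_c(ℝ≥0, ℝ))
    {K : ℝ≥0} (hf : ∀ u, K < u → f u = 0) {m : ℕ} (hm : K < ∑ j ∈ Finset.range m, s j) :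
    ∫ u, f u ∂(arrivalMeasure s) =
      ∑ k ∈ Finset.range m, f (∑ j ∈ Finset.range (k + 1), s j) := by
  have := isLocallyFiniteMeasure_arrivalMeasure hs
  have hint : Integrable f (arrivalMeasure s) :=
    f.continuous.integrable_of_hasCompactSupport f.hasCompactSupport
  have h1 := hasSum_integral_measure hint
  simp only [integral_dirac] at h1
  refine h1.unique (hasSum_sum_of_ne_finset_zero fun k hk => hf _ ?_)
  exact lt_sum_of_le hm (by simpa using hk)

/-- A locally finite measure as a point of `RadonHalfLine`. -/
def RadonHalfLine.of (ν : Measure ℝ≥0) (h : IsLocallyFiniteMeasure ν) : RadonHalfLine := ⟨ν, h⟩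

open Classical in
/-- The point process with gaps `s`. -/
noncomputable def pointProcess (s : ℕ → ℝ≥0) : RadonHalfLine :=
  if h : s ∈ divergentSeq then .of (arrivalMeasure s) (isLocallyFiniteMeasure_arrivalMeasure h)
  else .of 0 inferInstance

theorem pointProcess_val {s : ℕ → ℝ≥0} (h : s ∈ divergentSeq) :
    (pointProcess s).1 = arrivalMeasure s := by
  rw [pointProcess, dif_pos h]
  rfl

/-- A test function sees only `[0, K]`. If the first `m` gaps of `s` exceed `K` in sum, so do those
of nearby sequences, and the integral is there a fixed finite sum, continuous in the gaps. -/
theorem continuousOn_pointProcess : ContinuousOn pointProcess divergentSeq := by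
  rw [continuousOn_iff_continuous_domRestrict]
  refine continuous_induced_rng.2 (continuous_pi fun f => continuous_iff_continuousAt.2 fun s => ?_)
  obtain ⟨K, hK⟩ := f.hasCompactSupport.isCompact.bddAbove
  have hf : ∀ u, K < u → f u = 0 := fun u hu =>
    image_eq_zero_of_notMem_tsupport fun hmem => (hK hmem).not_gt hu
  obtain ⟨m, hm⟩ := exists_lt_sum_of_mem_divergentSeq s.2 K
  have hsum : ∀ k, Continuous fun s : divergentSeq => ∑ j ∈ Finset.range k, s.1 j := fun k =>
    continuous_finsetSum _ fun j _ => (continuous_apply j).comp continuous_subtype_val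
  have hev : ∀ᶠ s' : divergentSeq in 𝓝 s, K < ∑ j ∈ Finset.range m, s'.1 j :=
    (hsum m).continuousAt.eventually_const_lt hm
  have hcont : Continuous fun s : divergentSeq =>
      ∑ k ∈ Finset.range m, f (∑ j ∈ Finset.range (k + 1), s.1 j) :=
    continuous_finsetSum _ fun k _ => f.continuous.comp (hsum (k + 1))
  refine hcont.continuousAt.congr (hev.mono fun s' hs' => ?_)
  simp only [Function.comp_apply, Set.domRestrict_apply, pointProcess_val s'.2]
  exact (integral_arrivalMeasure s'.2 f hf hs').symm

open Classical in
theorem ContinuousOn.measurable_of_const_compl {α β : Type*} [TopologicalSpace α]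
    [MeasurableSpace α] [OpensMeasurableSpace α] [TopologicalSpace β] [MeasurableSpace β]
    [BorelSpace β] {f : α → β} {s : Set α} (hs : MeasurableSet s) (hf : ContinuousOn f s) {c : β}
    (hc : ∀ x ∉ s, f x = c) : Measurable f := by
  have : f = s.piecewise f fun _ => c := by
    ext x
    by_cases hx : x ∈ s
    · rw [Set.piecewise_eq_of_mem _ _ _ hx]
    · rw [Set.piecewise_eq_of_notMem _ _ _ hx, hc x hx]
  rw [this]
  exact hf.measurable_piecewise continuousOn_const hs

theorem measurable_pointProcess : Measurable pointProcess :=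
  continuousOn_pointProcess.measurable_of_const_compl measurableSet_divergentSeq
    fun s hs => by rw [pointProcess, dif_neg hs]

variable {X : Type*} {T : X → X} {I : Set X}

theorem Recurrent.sum_gapSeq (h : Recurrent T I) (ρ : ℝ≥0) (x : X) (k : ℕ) :
    ∑ j ∈ Finset.range k, gapSeq T I ρ x j = (entranceTime T I k x : ℝ≥0) * ρ := by
  induction k with
  | zero => simp [entranceTime]
  | succ k ih =>
    rw [Finset.sum_range_succ, ih, gapSeq, ← add_mul, ← Nat.cast_add,
      Nat.add_sub_cancel' (h.entranceTime_lt k x).le]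

theorem Recurrent.entranceProcess_eq [MeasurableSpace X] (h : Recurrent T I) (μ : Measure X)
    (x : X) : entranceProcess μ T I x = arrivalMeasure (gapSeq T I (μ I).toNNReal x) := by
  rw [entranceProcess, arrivalMeasure]
  simp only [h.sum_gapSeq]

theorem Recurrent.gapSeq_mem (h : Recurrent T I) {ρ : ℝ≥0} (hρ : 0 < ρ) (x : X) :
    gapSeq T I ρ x ∈ divergentSeq := by
  refine mem_divergentSeq hρ fun k => le_mul_of_one_le_left zero_le ?_
  have := h.entranceTime_lt (k + 1) x
  exact_mod_cast (by omega : 1 ≤ entranceTime T I (k + 1 + 1) x - entranceTime T I (k + 1) x)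

theorem Recurrent.scaledGap_eq [MeasurableSpace X] (h : Recurrent T I) (μ : Measure X) (k : ℕ)
    (x : X) : scaledGap μ T I k x = gapSeq T I (μ I).toNNReal x k := by
  rw [scaledGap, gapSeq, NNReal.coe_mul, NNReal.coe_natCast,
    Nat.cast_sub (h.entranceTime_lt k x).le]
  rfl

end PointProcess

namespace StationaryDiagram

/-! ### The limit law -/

section LimitLaw

open scoped ENNReal

variable {V E : Type*} [Fintype V] [Nonempty V] [Fintype E] [PartialOrder E]
  {B : StationaryDiagram V E} {lam : ℝ} {r l : V → ℝ} {μ : Measure B.PathSpace}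
  [IsProbabilityMeasure μ]

variable (B) in
/-- The limit law of the sequence of gaps. -/
noncomputable def limitLaw (μ : Measure B.PathSpace) (r l : V → ℝ) (i : V) : Measure (ℕ → ℝ≥0) :=
  ((B.towerMeasure μ i).restrict (B.limitSet l i)).map (B.limitGaps r l i)

/-- The set of sequences whose first `q + 1` terms are bounded by `t`. -/
def lowerBox {q : ℕ} (t : Fin (q + 1) → ℝ) : Set (ℕ → ℝ≥0) :=
  {s | ∀ k : Fin (q + 1), (s k : ℝ) ≤ t k}

theorem isClosed_lowerBox {q : ℕ} (t : Fin (q + 1) → ℝ) : IsClosed (lowerBox t) := by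
  simp only [lowerBox, Set.ofPred_forall]
  exact isClosed_iInter fun k => isClosed_le
    (NNReal.continuous_coe.comp (continuous_apply (k : ℕ))) continuous_const

theorem IsPerron.measure_path (h : B.IsPerron lam r l) (hlam : 0 < lam)
    (hB : B.ProperlyOrdered) (H1 : ∀ i j : V, ∃ e : E, B.src e = i ∧ B.tgt e = j)
    (hμ : MeasurePreserving B.vershik μ μ) {i : V} {p : ℕ} {w : Fin (p + 1) → E}
    (hw : B.IsPathFrom i w) :
    μ {z | ∀ j : Fin (p + 1), z.1 j = w j} =
      ENNReal.ofReal (r (B.tgt (w (Fin.last p))) / lam ^ (p + 1)) := by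
  obtain ⟨z, hz⟩ := B.exists_path_through i w hw
  have h1 : {y : B.PathSpace | ∀ j : Fin (p + 1), y.1 j = w j} = B.cylinder z (p + 1) := by
    ext y
    refine ⟨fun hy => ?_, fun hy j => (hy.2 j j.2).trans (hz j)⟩
    have h2 : ∀ j < p + 1, y.1 j = z.1 j := fun j hj => (hy ⟨j, hj⟩).trans (hz ⟨j, hj⟩).symm
    exact ⟨congrArg B.src (h2 0 (Nat.succ_pos p)), h2⟩
  rw [h1, h.measure_cylinder hlam hB H1 hμ, ← z.2 p]
  have h3 := hz (Fin.last p)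
  rw [Fin.val_last] at h3
  rw [h3]

omit [Fintype V] [Nonempty V] [Fintype E] in
theorem isPathFrom_of_mem_base {i : V} {z : B.PathSpace} (hz : z ∈ B.base i) (p : ℕ) :
    B.IsPathFrom i fun j : Fin (p + 1) => z.1 j :=
  ⟨hz, fun j => z.2 j⟩

open Classical in
-- Everything is read off the first `q + 2` edges. Over each such path the event is a rectangle, the
-- cylinder of the path times an interval for the first gap, or is empty when a later gap exceeds
-- its bound.
theorem IsPerron.limitLaw_lowerBox (h : B.IsPerron lam r l) (hlam : 0 < lam)
    (hB : B.ProperlyOrdered) (H1 : ∀ i j : V, ∃ e : E, B.src e = i ∧ B.tgt e = j) {one : V}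
    (H3 : ∀ e : E, IsMin e → B.src e = one) (hμ : MeasurePreserving B.vershik μ μ) (i : V)
    (q : ℕ) (t : Fin (q + 1) → ℝ) :
    (B.limitLaw μ r l i).real (lowerBox t) = B.limitCdf lam r l i q t := by
  have hV := hμ.measurable
  have hri := h.right_pos i
  set paths := Finset.univ.filter fun w : Fin (q + 2) → E => B.IsPathFrom i w with hpaths
  set cond : (Fin (q + 2) → E) → Prop := fun w =>
    ∀ k : Fin q, B.cbar l i (B.returnPair i (k + 1) w) ≤ t k.succ / r i with hcond
  set J : (Fin (q + 2) → E) → Set ℝ := fun w =>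
    if cond w then Set.Ioc 0 (min (t 0 / r i) (B.cbar l i (w 0, w 1))) else ∅ with hJ
  set cyl : (Fin (q + 2) → E) → Set B.PathSpace := fun w => {z | ∀ j : Fin (q + 2), z.1 j = w j}
    with hcyl
  have hJm : ∀ w, MeasurableSet (J w) := fun w => by
    simp only [hJ]
    split_ifs
    exacts [measurableSet_Ioc, MeasurableSet.empty]
  have hcm : ∀ w, MeasurableSet (cyl w) := fun w => by
    have : cyl w = ⋂ j : Fin (q + 2), {z : B.PathSpace | z.1 j ∈ ({w j} : Set E)} := by
      ext z
      simp [hcyl]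
    rw [this]
    exact MeasurableSet.iInter fun j => measurableSet_coord _ _
  have hset : B.limitGaps r l i ⁻¹' lowerBox t ∩ B.limitSet l i ∩ B.base i ×ˢ Set.Ioi 0 =
      ⋃ w ∈ paths, cyl w ×ˢ J w := by
    have key : ∀ z ∈ B.base i, ∀ s : ℝ, 0 < s → ∀ w : Fin (q + 2) → E,
        (∀ j : Fin (q + 2), z.1 j = w j) →
        ((B.limitGaps r l i (z, s) ∈ lowerBox t ∧ (z, s) ∈ B.limitSet l i) ↔ s ∈ J w) := by
      intro z hz s hs w hw
      have h0 : B.pairAt i 0 z = (w 0, w 1) := Prod.ext (hw 0) (hw 1)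
      have hk : ∀ k : Fin q, B.pairAt i (k + 1) z = B.returnPair i (k + 1) w := fun k =>
        (returnPair_eq_pairAt hB H1 H3 i z (by omega) hw).symm
      have h1 : B.limitGaps r l i (z, s) ∈ lowerBox t ↔ s ≤ t 0 / r i ∧ cond w := by
        rw [lowerBox, Set.mem_ofPred_eq, Fin.forall_fin_succ]
        refine and_congr ?_ (forall_congr' fun k => ?_)
        · show ((r i * s).toNNReal : ℝ) ≤ t 0 ↔ _
          rw [Real.coe_toNNReal _ (by positivity), le_div_iff₀ hri, mul_comm]
        · show ((r i * B.cbar l i (B.pairAt i (k + 1) z)).toNNReal : ℝ) ≤ t k.succ ↔ _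
          have := (h.left_pos i).le.trans (le_cbar_pairAt hB H1 H3 h.left_pos i (k + 1) z)
          rw [Real.coe_toNNReal _ (by positivity), le_div_iff₀ hri, mul_comm, hk]
      have h2 : (z, s) ∈ B.limitSet l i ↔ s ≤ B.cbar l i (w 0, w 1) := by
        rw [← h0]
        rfl
      rw [h1, h2]
      by_cases hc : cond w
      · simp [hJ, hc, hs]
      · simp [hJ, hc]
    ext ⟨z, s⟩
    simp only [Set.mem_iUnion, hpaths, Finset.mem_filter, Finset.mem_univ, true_and, exists_prop]
    constructor
    · rintro ⟨⟨h1, h2⟩, hz, hs⟩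
      exact ⟨fun j => z.1 j, isPathFrom_of_mem_base hz (q + 1), fun j => rfl,
        (key z hz s hs _ fun j => rfl).1 ⟨h1, h2⟩⟩
    · rintro ⟨w, hw, hzw, hsw⟩
      have hz : z ∈ B.base i := (congrArg B.src (hzw 0)).trans hw.1
      have hs : 0 < s := by
        have h3 : s ∈ J w := hsw
        simp only [hJ] at h3
        split_ifs at h3
        · exact h3.1
        · exact absurd h3 (Set.notMem_empty s)
      exact ⟨(key z hz s hs w hzw).2 hsw, hz, hs⟩
  have hbox := (isClosed_lowerBox t).measurableSet
  have hgm := measurable_limitGaps hB H1 hV r l i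
  rw [limitLaw, Measure.real, Measure.map_apply hgm hbox,
    Measure.restrict_apply (hgm hbox), towerMeasure, Measure.prod_restrict,
    Measure.restrict_apply ((hgm hbox).inter (measurableSet_limitSet hB H1 hV l i)), hset,
    measure_biUnion_finset ?_ fun w _ => (hcm w).prod (hJm w)]
  · have hterm : ∀ w ∈ paths, (μ.prod volume) (cyl w ×ˢ J w) =
        ENNReal.ofReal (r (B.tgt (w (Fin.last (q + 1)))) / lam ^ (q + 2)) *
          (if cond w then ENNReal.ofReal (min (t 0 / r i) (B.cbar l i (w 0, w 1))) else 0) := by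
      intro w hw
      rw [Measure.prod_prod, h.measure_path hlam hB H1 hμ (Finset.mem_filter.1 hw).2]
      congr 1
      simp only [hJ]
      split_ifs
      · rw [Real.volume_Ioc, sub_zero]
      · exact measure_empty
    rw [Finset.sum_congr rfl hterm, ENNReal.toReal_sum, limitCdf]
    · refine Finset.sum_congr rfl fun w _ => ?_
      have hr0 := h.right_pos (B.tgt (w (Fin.last (q + 1))))
      have hc0 : 0 ≤ B.cbar l i (w 0, w 1) :=
        Finset.sum_nonneg fun v _ => mul_nonneg (Nat.cast_nonneg _) (h.left_pos v).le
      rw [ENNReal.toReal_mul, ENNReal.toReal_ofReal (by positivity), Finset.prod_ite_zero,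
        mul_comm]
      congr 1
      simp only [Finset.mem_univ, true_implies, Finset.prod_const_one]
      by_cases hc : cond w
      -- A negative `t 0` gives an empty interval: the truncation in `ofReal` produces the positive
      -- part in `F`.
      · rw [if_pos hc, if_pos hc, mul_one, ENNReal.toReal_ofReal', max_min_distrib_right,
          max_eq_left hc0, ← max_div_div_right hri.le, zero_div]
      · rw [if_neg hc, if_neg hc, mul_zero, ENNReal.toReal_zero]
    · intro w _
      refine ENNReal.mul_ne_top ENNReal.ofReal_ne_top ?_
      split_ifs
      exacts [ENNReal.ofReal_ne_top, ENNReal.zero_ne_top]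
  · intro w _ w' _ hww'
    refine Set.disjoint_left.2 fun p hp hp' => hww' (funext fun j => ?_)
    exact (hp.1 j).symm.trans (hp'.1 j)

variable {x : B.PathSpace} {i : V} {N : ℕ → ℕ}

theorem IsPerron.toNNReal_measure_cylinder (h : B.IsPerron lam r l) (hlam : 0 < lam)
    (hB : B.ProperlyOrdered) (H1 : ∀ i j : V, ∃ e : E, B.src e = i ∧ B.tgt e = j)
    (hμ : MeasurePreserving B.vershik μ μ) {n : ℕ} (hx : B.src (x.1 n) = i) :
    (μ (B.cylinder x n)).toNNReal = (r i / lam ^ n).toNNReal := by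
  rw [h.measure_cylinder hlam hB H1 hμ, hx]
  rfl

theorem IsPerron.tendsto_lintegral_gapSeq (h : B.IsPerron lam r l) (hlam : 1 < lam)
    (hB : B.ProperlyOrdered) (H1 : ∀ i j : V, ∃ e : E, B.src e = i ∧ B.tgt e = j) {one : V}
    (H3 : ∀ e : E, IsMin e → B.src e = one) (hμ : MeasurePreserving B.vershik μ μ)
    (hN : StrictMono N) (hx : ∀ a, B.src (x.1 (N a)) = i) {Φ : (ℕ → ℝ≥0) → ℝ≥0∞}
    (hΦ : Measurable Φ) (hΦc : ContinuousOn Φ divergentSeq) {C : ℝ≥0∞} (hC : C ≠ ∞)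
    (hΦC : ∀ s, Φ s ≤ C) :
    Tendsto (fun a => ∫⁻ y, Φ (gapSeq B.vershik (B.cylinder x (N a))
        (μ (B.cylinder x (N a))).toNNReal y) ∂μ) atTop
      (𝓝 (∫⁻ s, Φ s ∂(B.limitLaw μ r l i))) := by
  have hlam0 : 0 < lam := one_pos.trans hlam
  rw [limitLaw, lintegral_map hΦ (measurable_limitGaps hB H1 hμ.measurable r l i)]
  refine ((h.tendsto_lintegral_towerGaps hlam hB H1 H3 hμ.measurable i hΦ hΦc hC hΦC).comp
    hN.tendsto_atTop).congr fun a => ?_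
  rw [h.toNNReal_measure_cylinder hlam0 hB H1 hμ (hx a)]
  exact (h.lintegral_gapSeq hlam0 hB H1 H3 hμ (hx a) hΦ hC hΦC).symm

/-- Total mass is preserved by testing the convergence against the constant `1`. -/
theorem IsPerron.isProbabilityMeasure_limitLaw (h : B.IsPerron lam r l) (hlam : 1 < lam)
    (hB : B.ProperlyOrdered) (H1 : ∀ i j : V, ∃ e : E, B.src e = i ∧ B.tgt e = j) {one : V}
    (H3 : ∀ e : E, IsMin e → B.src e = one) (hμ : MeasurePreserving B.vershik μ μ)
    (hN : StrictMono N) (hx : ∀ a, B.src (x.1 (N a)) = i) :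
    IsProbabilityMeasure (B.limitLaw μ r l i) := by
  have h1 := h.tendsto_lintegral_gapSeq hlam hB H1 H3 hμ hN hx (Φ := fun _ => 1)
    measurable_const continuousOn_const ENNReal.one_ne_top fun _ => le_rfl
  simp only [lintegral_const, measure_univ, one_mul] at h1
  exact ⟨(tendsto_nhds_unique h1 tendsto_const_nhds)⟩

omit [IsProbabilityMeasure μ] in
theorem IsPerron.ae_limitLaw_mem (h : B.IsPerron lam r l) (hB : B.ProperlyOrdered)
    (H1 : ∀ i j : V, ∃ e : E, B.src e = i ∧ B.tgt e = j) {one : V}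
    (H3 : ∀ e : E, IsMin e → B.src e = one) (hμ : MeasurePreserving B.vershik μ μ) :
    ∀ᵐ s ∂(B.limitLaw μ r l i), s ∈ divergentSeq :=
  (ae_map_iff (measurable_limitGaps hB H1 hμ.measurable r l i).aemeasurable
    measurableSet_divergentSeq).2 (Eventually.of_forall fun p => h.limitGaps_mem hB H1 H3 i p)

/-- Functionals of the gap sequence that are continuous on `divergentSeq` converge in law. -/
theorem IsPerron.tendstoInDistribution (h : B.IsPerron lam r l) (hlam : 1 < lam)
    (hB : B.ProperlyOrdered) (H1 : ∀ i j : V, ∃ e : E, B.src e = i ∧ B.tgt e = j) {one : V}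
    (H3 : ∀ e : E, IsMin e → B.src e = one) (hμ : MeasurePreserving B.vershik μ μ)
    (hN : StrictMono N) (hx : ∀ a, B.src (x.1 (N a)) = i)
    [IsProbabilityMeasure (B.limitLaw μ r l i)] {Y : Type*} [TopologicalSpace Y]
    [MeasurableSpace Y] [OpensMeasurableSpace Y] {G : (ℕ → ℝ≥0) → Y} (hG : Measurable G)
    (hGc : ContinuousOn G divergentSeq) :
    TendstoInDistribution (fun a y => G (gapSeq B.vershik (B.cylinder x (N a))
      (μ (B.cylinder x (N a))).toNNReal y)) atTop G (fun _ => μ) (B.limitLaw μ r l i) := by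
  have hm : ∀ a, Measurable fun y => G (gapSeq B.vershik (B.cylinder x (N a))
      (μ (B.cylinder x (N a))).toNNReal y) := fun a =>
    hG.comp ((recurrent_cylinder hB H1 x (N a)).measurable_gapSeq hμ.measurable
      (isOpen_cylinder x (N a)).measurableSet _)
  refine ⟨fun a => (hm a).aemeasurable, hG.aemeasurable, ?_⟩
  refine ProbabilityMeasure.tendsto_iff_forall_lintegral_tendsto.2 fun f => ?_
  have hfm : Measurable fun y => (f y : ℝ≥0∞) := f.continuous.measurable.coe_nnreal_ennreal
  have h1 := h.tendsto_lintegral_gapSeq hlam hB H1 H3 hμ hN hx (Φ := fun s => (f (G s) : ℝ≥0∞))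
    (hfm.comp hG) ((ENNReal.continuous_coe.comp f.continuous).comp_continuousOn hGc)
    (C := (nndist 0 f : ℝ≥0)) ENNReal.coe_ne_top
    (fun s => ENNReal.coe_le_coe.2 (f.apply_le_nndist_zero _))
  refine (h1.congr fun a => (lintegral_map hfm (hm a)).symm).trans ?_
  rw [← lintegral_map hfm hG]
  rfl

theorem IsPerron.tendsto_limitCdf (h : B.IsPerron lam r l) (hlam : 1 < lam)
    (hB : B.ProperlyOrdered) (H1 : ∀ i j : V, ∃ e : E, B.src e = i ∧ B.tgt e = j) {one : V}
    (H3 : ∀ e : E, IsMin e → B.src e = one) (hμ : MeasurePreserving B.vershik μ μ)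
    (hN : StrictMono N) (hx : ∀ a, B.src (x.1 (N a)) = i) (q : ℕ) (t : Fin (q + 1) → ℝ)
    (ht : ContinuousAt (B.limitCdf lam r l i q) t) :
    Tendsto (fun a => μ.real {y | ∀ k : Fin (q + 1),
      scaledGap μ B.vershik (B.cylinder x (N a)) k y ≤ t k}) atTop
      (𝓝 (B.limitCdf lam r l i q t)) := by
  have hlam0 : 0 < lam := one_pos.trans hlam
  have := h.isProbabilityMeasure_limitLaw hlam hB H1 H3 hμ hN hx
  set ν := B.limitLaw μ r l i with hν
  have hcdf : ∀ t : Fin (q + 1) → ℝ, ν.real (lowerBox t) = B.limitCdf lam r l i q t := fun t =>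
    h.limitLaw_lowerBox hlam0 hB H1 H3 hμ i q t
  -- A boundary point of the box lies outside each smaller box `t - ε`, so the boundary has mass at
  -- most `F t - F (t - ε)`, which continuity at `t` sends to zero.
  have hfrontier : ν (frontier (lowerBox t)) = 0 := by
    rw [← measureReal_eq_zero_iff]
    have hle : ∀ ε : ℝ, 0 < ε → ν.real (frontier (lowerBox t)) ≤
        B.limitCdf lam r l i q t - B.limitCdf lam r l i q (fun k => t k - ε) := by
      intro ε hε
      have hsub : lowerBox (fun k => t k - ε) ⊆ lowerBox t := fun s hs k =>
        (hs k).trans (by linarith)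
      rw [← hcdf, ← hcdf, ← measureReal_sdiff hsub (isClosed_lowerBox _).measurableSet]
      refine measureReal_mono fun s hs => ⟨(isClosed_lowerBox t).frontier_subset hs, fun hs' => ?_⟩
      have hopen : IsOpen {s : ℕ → ℝ≥0 | ∀ k : Fin (q + 1), (s k : ℝ) < t k} := by
        simp only [Set.ofPred_forall]
        exact isOpen_iInter_of_finite fun k => isOpen_lt
          (NNReal.continuous_coe.comp (continuous_apply (k : ℕ))) continuous_const
      have hint : s ∈ interior (lowerBox t) :=
        mem_interior.2 ⟨_, fun u hu k => (hu k).le, hopen, fun k =>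
          (hs' k).trans_lt (by linarith)⟩
      exact hs.2 hint
    have hlim : Tendsto (fun ε : ℝ => B.limitCdf lam r l i q t -
        B.limitCdf lam r l i q (fun k => t k - ε)) (𝓝[>] 0) (𝓝 0) := by
      have h1 : Tendsto (fun ε : ℝ => fun k => t k - ε) (𝓝[>] 0) (𝓝 t) := by
        refine tendsto_pi_nhds.2 fun k => ?_
        have h2 : Tendsto (fun ε : ℝ => t k - ε) (𝓝 0) (𝓝 (t k - 0)) :=
          (continuous_const.sub continuous_id).tendsto 0
        rw [sub_zero] at h2
        exact h2.mono_left nhdsWithin_le_nhds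
      simpa using (ht.tendsto.comp h1).const_sub (B.limitCdf lam r l i q t)
    exact le_antisymm (ge_of_tendsto hlim (eventually_nhdsWithin_of_forall hle)) measureReal_nonneg
  have hconv := (h.tendstoInDistribution hlam hB H1 H3 hμ hN hx (G := id) measurable_id
    continuousOn_id).tendsto
  have h1 : Tendsto (fun a => (μ.map (gapSeq B.vershik (B.cylinder x (N a))
      (μ (B.cylinder x (N a))).toNNReal)) (lowerBox t)) atTop (𝓝 ((ν.map id) (lowerBox t))) :=
    ProbabilityMeasure.tendsto_measure_of_null_frontier_of_tendsto' hconv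
      (show (ν.map id) (frontier (lowerBox t)) = 0 by rw [Measure.map_id]; exact hfrontier)
  rw [Measure.map_id] at h1
  rw [← hcdf]
  have h2 := (ENNReal.tendsto_toReal (measure_ne_top _ _)).comp h1
  refine h2.congr fun a => ?_
  have hrec := recurrent_cylinder hB H1 x (N a)
  rw [Function.comp_apply, Measure.map_apply (hrec.measurable_gapSeq hμ.measurable
      (isOpen_cylinder x (N a)).measurableSet _) (isClosed_lowerBox t).measurableSet, Measure.real]
  congr 2
  ext y
  simp only [hrec.scaledGap_eq, lowerBox, Set.mem_preimage, Set.mem_ofPred_eq]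

end LimitLaw

end StationaryDiagram

theorem mainTheorem3 {V E : Type*} [Fintype V] [Nonempty V] [Fintype E] [PartialOrder E]
    (B : StationaryDiagram V E) (hproper : B.ProperlyOrdered) [PerfectSpace B.PathSpace]
    (H1 : ∀ i j : V, ∃ e : E, B.src e = i ∧ B.tgt e = j)
    (one : V) (H3 : ∀ e : E, IsMin e → B.src e = one)
    (lam : ℝ) (r l : V → ℝ) (hperron : B.IsPerron lam r l)
    (μ : Measure B.PathSpace) [IsProbabilityMeasure μ]
    (hμ : MeasurePreserving B.vershik μ μ)
    (xstar : B.PathSpace) (istar : V) (N : ℕ → ℕ) (hN : StrictMono N)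
    (hNstar : ∀ a, B.src (xstar.1 (N a)) = istar) :
    -- the numbers `c(ef)(v)` describe the passages of the points of `[I_n ef]`
    (∀ a, ∀ x ∈ B.cylinder xstar (N a), ∀ v : V,
      Set.ncard {j : ℕ | 0 < j ∧
          j ≤ entranceTime B.vershik (B.cylinder xstar (N a)) 1 x ∧
          B.vershik^[j] x ∈ B.minCylinder (N a) v} =
        B.passageCount istar (x.1 (N a)) (x.1 (N a + 1)) v) ∧
    -- the `k`-th return to `I_n` of a point of `[I_n e₁ ⋯ e_{p+1}]` lies in
    -- `[I_n e₁^{(k+1)} e₂^{(k+1)}]`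
    (∀ a, ∀ x ∈ B.cylinder xstar (N a), ∀ q k : ℕ, k ≤ q →
      ∃ y ∈ B.cylinder xstar (N a),
        y = B.vershik^[entranceTime B.vershik (B.cylinder xstar (N a)) k x] x ∧
        (y.1 (N a), y.1 (N a + 1)) =
          B.returnPair istar k (fun j : Fin (q + 2) => x.1 (N a + j))) ∧
    -- convergence of the finite-dimensional distributions of the inter-arrival times
    (∀ (q : ℕ) (t : Fin (q + 1) → ℝ), ContinuousAt (B.limitCdf lam r l istar q) t →
      Tendsto
        (fun a => μ.real {x | ∀ k : Fin (q + 1),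
          scaledGap μ B.vershik (B.cylinder xstar (N a)) k x ≤ t k})
        atTop (𝓝 (B.limitCdf lam r l istar q t))) ∧
    -- convergence in law of the point processes
    ∃ (ν : Measure (ℕ → ℝ≥0)) (_ : IsProbabilityMeasure ν)
      (τ : ℕ → B.PathSpace → RadonHalfLine) (τlim : (ℕ → ℝ≥0) → RadonHalfLine),
      (∀ (q : ℕ) (t : Fin (q + 1) → ℝ),
        ν.real {s | ∀ k : Fin (q + 1), (s k : ℝ) ≤ t k} = B.limitCdf lam r l istar q t) ∧
      (∀ a x, (τ a x).1 = entranceProcess μ B.vershik (B.cylinder xstar (N a)) x) ∧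
      (∀ᵐ s ∂ν, (τlim s).1 = arrivalMeasure s) ∧
      TendstoInDistribution τ atTop τlim (fun _ => μ) ν := by
  have hlam := hperron.one_lt H1
  have hlam0 : 0 < lam := one_pos.trans hlam
  have hν := hperron.isProbabilityMeasure_limitLaw hlam hproper H1 H3 hμ hN hNstar
  refine ⟨fun a x hx v => StationaryDiagram.ncard_passages hproper H1 H3 (hNstar a) hx v,
    fun a x hx q k hk => ?_,
    fun q t ht => hperron.tendsto_limitCdf hlam hproper H1 H3 hμ hN hNstar q t ht,
    -- One law on gap sequences has every `F` as its finite-dimensional distribution function and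
    -- carries the limiting point process.
    B.limitLaw μ r l istar, hν,
    fun a x => pointProcess (gapSeq B.vershik (B.cylinder xstar (N a))
      (μ (B.cylinder xstar (N a))).toNNReal x), pointProcess,
    fun q t => hperron.limitLaw_lowerBox hlam0 hproper H1 H3 hμ istar q t,
    fun a x => ?_, ?_,
    hperron.tendstoInDistribution hlam hproper H1 H3 hμ hN hNstar measurable_pointProcess
      continuousOn_pointProcess⟩
  · obtain ⟨h1, h2⟩ := StationaryDiagram.tail_iterate_entranceTime hproper H1 (hNstar a) hx k
    refine ⟨_, h2, rfl, ?_⟩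
    have h3 := StationaryDiagram.returnPair_eq_pairAt hproper H1 H3 istar (B.tail (N a) x) hk
      (w := fun j : Fin (q + 2) => x.1 (N a + j)) fun _ => rfl
    exact (congrArg (fun z : B.PathSpace => (z.1 0, z.1 1)) h1).trans h3.symm
  · have hrec := StationaryDiagram.recurrent_cylinder hproper H1 xstar (N a)
    rw [hrec.entranceProcess_eq, pointProcess_val (hrec.gapSeq_mem ?_ x)]
    rw [hperron.toNNReal_measure_cylinder hlam0 hproper H1 hμ (hNstar a), Real.toNNReal_pos]
    exact div_pos (hperron.right_pos istar) (by positivity)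
  · exact (hperron.ae_limitLaw_mem hproper H1 H3 hμ).mono fun s hs => pointProcess_val hs
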